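/- For a prime $p$ and $K \in \mathbb{N}$ write $[-K,K] = \{-K, -(K-1), \ldots, K-1, K\}$, regarded as a subset of $\mathbb{F}_p$. A linear function on $\mathbb{F}_p^d$ is a map $\xi(x_1,\ldots,x_d) = a_0 + a_1 x_1 + \cdots + a_d x_d$ with $a_0, \ldots, a_d \in \mathbb{F}_p$. A finite multiset $X$ in $\mathbb{F}_p^d$ is called $(K,\delta)$-thick along $\xi$ if at least $\delta |X|$ elements $x$ of $X$ satisfy $\xi(x) \notin [-K,K]$, where elements and the cardinality $|X|$ are counted with multiplicity. Proposition 1. Let $d \ge 1$ and $K \ge 1$ be integers and let $\delta > 0$ and $\mu > 0$ be real numbers. There are $K_0 = K_0(K,d,\delta,\mu)$ and $p_0 = p_0(d,K,\delta,\mu)$ such that the following holds for every integer $K_2 > K$ with $K_2 \ge K_0$, every prime $p > p_0$ and every integer $l \in [0,d]$. Identify $\mathbb{F}_p^d$ with $\mathbb{F}_p^l \times \mathbb{F}_p^{d-l}$. Let $Y \subset [-K,K]^l \subset \mathbb{F}_p^l$ be a non-empty set and, for each $y \in Y$, let $X_y$ be a finite multiset of elements of $\{y\} \times \mathbb{F}_p^{d-l}$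 of size at least $\mu p$. Let $X = \bigcup_{y \in Y} X_y$ (a union of multisets, with multiplicities), and suppose that $X$ is $(K_2,\delta)$-thick along every linear function that is not constant on $\{0\} \times \mathbb{F}_p^{d-l}$. Then there are $u_0 \in \mathbb{F}_p^l$ and $k \in \mathbb{N}$ such that for every $u \in \mathbb{F}_p^{d-l}$ there are sub-multisets $S_y \subset X_y$ $(y \in Y)$ with $$\sum_{y \in Y} \sum_{x \in S_y} x = (u_0, u) \qquad \text{and} \qquad \sum_{y \in Y} |S_y| = k.$$ -/

import Mathlib

namespace SubsetSums

/-- The interval `{-K, -(K-1), …, K-1, K}`, regarded as a subset of `𝔽_p`. -/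
def interval (p K : ℕ) : Set (ZMod p) :=
  {t | ∃ n : ℤ, -(K : ℤ) ≤ n ∧ n ≤ (K : ℤ) ∧ (n : ZMod p) = t}

/-- The slab `H(ξ, K) = {x | ξ(x) ∈ [-K, K]}` of a function `ξ(x) = a₀ + a₁ x₁ + ⋯ + a_n x_n`,
that is, of an affine map `ξ : 𝔽_p^n → 𝔽_p`. -/
def slab {p n : ℕ} (ξ : (Fin n → ZMod p) →ᵃ[ZMod p] ZMod p) (K : ℕ) : Set (Fin n → ZMod p) :=
  {x | ξ x ∈ interval p K}

open Classical in
/-- The multiset `X` is `(K, δ)`-thick along `ξ`: `|X \ H(ξ, K)| ≥ δ |X|`, where cardinalities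
are counted with multiplicity. -/
def Thick {p n : ℕ} (X : Multiset (Fin n → ZMod p)) (K : ℕ) (δ : ℝ)
    (ξ : (Fin n → ZMod p) →ᵃ[ZMod p] ZMod p) : Prop :=
  δ * (Multiset.card X : ℝ) ≤ (Multiset.card (X.filter (fun x => x ∉ slab ξ K)) : ℝ)

/-- The set `{y} × 𝔽_p^m`, inside `𝔽_p^(l+m) = 𝔽_p^l × 𝔽_p^m`. -/
def fiber {p l : ℕ} (m : ℕ) (y : Fin l → ZMod p) : Set (Fin (l + m) → ZMod p) :=
  {x | ∃ v : Fin m → ZMod p, x = Fin.append y v}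

/-- The function `ξ` is constant on the set `A`. -/
def ConstantOn {p n : ℕ} (ξ : (Fin n → ZMod p) →ᵃ[ZMod p] ZMod p)
    (A : Set (Fin n → ZMod p)) : Prop :=
  ∀ x ∈ A, ∀ x' ∈ A, ξ x = ξ x'

end SubsetSums

/-! Lift the points of `Y` to integer vectors in `[-K,K]^l` and prefix a 1. Each element of `X` then
has a type in `ℤ^(l+1)`, and the integer sum of the types of a subset fixes both its first `l`
coordinates and its size. For given `d` and `K` only finitely many sets of types occur, so constants
may depend on that set. What remains is to reach every value of the other `m = d - l` coordinates by
subsets with one common type sum (`exists_subset_sums`).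

A move is a difference of two subset sums with equal type sums. If a set `A` of sums is realized
away from the support of a move `v`, then `v` enlarges `A` by the number of `a ∈ A` with `a + v ∉
A`. Two mechanisms make this number large. Moves avoiding any small set span `𝔽_p^m`, so an
isoperimetric inequality yields `c k^m` sums from `k` moves (`exists_realizes_pow`): a positive
proportion of the space when `k` is a small multiple of `p`. Moreover, by Fourier analysis
(`le_sum_exitCount`), moves that often leave `[-T,T]` along every non-zero functional include one
that enlarges a given set of density at most 1/2 by a factor `1 + cT/p`; for large `T` another
multiple of `p` such moves passes density 1/2. Two such sets with disjoint supports add up to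
everything.

Thickness provides the moves. If a functional `x` is small on all balanced combinations of a few
reference elements, then on these it is, up to a bounded error, a linear function of the type
(`exists_linear_approx`, by Smith normal form). Subtracting that function gives an affine `ξ` that
is small on the references; thickness along `ξ` supplies many elements whose difference from the
reference of the same type is not small under `x`. -/

namespace SubsetSums

/-! ### Arithmetic of the intervals `[-K,K]` in `𝔽_p`. -/

theorem zero_mem_interval (p K : ℕ) : (0 : ZMod p) ∈ interval p K :=
  ⟨0, by omega, by omega, by simp⟩

theorem mem_interval_zero {p : ℕ} {x : ZMod p} : x ∈ interval p 0 ↔ x = 0 := by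
  constructor
  · rintro ⟨n, h1, h2, rfl⟩
    have : n = 0 := by push_cast at h1 h2; omega
    simp [this]
  · rintro rfl
    exact zero_mem_interval p 0

theorem interval_mono {p K K' : ℕ} (h : K ≤ K') : interval p K ⊆ interval p K' := by
  rintro _ ⟨n, h1, h2, rfl⟩
  exact ⟨n, by omega, by omega, rfl⟩

theorem neg_mem_interval {p K : ℕ} {x : ZMod p} (h : x ∈ interval p K) : -x ∈ interval p K := by
  obtain ⟨n, h1, h2, rfl⟩ := h
  exact ⟨-n, by omega, by omega, by push_cast; rfl⟩

theorem add_mem_interval {p K K' : ℕ} {x y : ZMod p} (hx : x ∈ interval p K)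
    (hy : y ∈ interval p K') : x + y ∈ interval p (K + K') := by
  obtain ⟨n, h1, h2, rfl⟩ := hx
  obtain ⟨k, h3, h4, rfl⟩ := hy
  exact ⟨n + k, by push_cast; omega, by push_cast; omega, by push_cast; rfl⟩

theorem sub_mem_interval {p K K' : ℕ} {x y : ZMod p} (hx : x ∈ interval p K)
    (hy : y ∈ interval p K') : x - y ∈ interval p (K + K') := by
  rw [sub_eq_add_neg]
  exact add_mem_interval hx (neg_mem_interval hy)

theorem sum_mem_interval {p K : ℕ} {κ : Type*} (s : Finset κ) {f : κ → ZMod p}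
    (h : ∀ i ∈ s, f i ∈ interval p K) : ∑ i ∈ s, f i ∈ interval p (s.card * K) := by
  classical
  induction s using Finset.induction_on with
  | empty => simpa using zero_mem_interval p _
  | insert a s ha ih =>
    rw [Finset.sum_insert ha, Finset.card_insert_of_notMem ha, add_mul, one_mul]
    rw [add_comm (f a)]
    exact add_mem_interval (ih fun i hi => h i (Finset.mem_insert_of_mem hi))
      (h a (Finset.mem_insert_self a s))

theorem lt_abs_valMinAbs_of_notMem_interval {p K : ℕ} [NeZero p] {x : ZMod p}
    (h : x ∉ interval p K) : (K : ℤ) < |x.valMinAbs| := by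
  by_contra! hc
  rw [abs_le] at hc
  exact h ⟨x.valMinAbs, hc.1, hc.2, x.coe_valMinAbs⟩

/-! ### Functions that almost respect integer relations are almost linear. -/

section Relations

variable {ι : Type*} [Fintype ι] {n : ℕ}

/-- The elements of the fibers of `ι × Fin (R + 1) → ι`, the `i`-th one truncated to its first
`r i` elements. -/
def initialPart (R : ℕ) (r : ι → ℕ) : Finset (ι × Fin (R + 1)) :=
  Finset.univ.filter fun q => (q.2 : ℕ) < r q.1

theorem sum_initialPart {M : Type*} [AddCommMonoid M] {R : ℕ} {r : ι → ℕ} (hr : ∀ i, r i ≤ R)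
    (f : ι → M) : ∑ q ∈ initialPart R r, f q.1 = ∑ i, r i • f i := by
  classical
  rw [initialPart, Finset.sum_filter, Fintype.sum_prod_type]
  refine Finset.sum_congr rfl fun i _ => ?_
  dsimp only
  rw [← Finset.sum_filter, Finset.sum_const]
  congr 1
  rw [Fin.card_filter_val_lt]
  have := hr i
  omega

/-- An integer relation among the vectors `t i` with coefficients at most `R` almost annihilates
`c (·, 0)`, if equal sums of at most `R + 1` copies of each `t i` have almost equal sums of `c`. -/
theorem relation_mem_interval {p R T : ℕ} {t : ι → Fin n → ℤ} {c : ι × Fin (R + 1) → ZMod p}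
    (hc : ∀ S S' : Finset (ι × Fin (R + 1)), ∑ q ∈ S, t q.1 = ∑ q ∈ S', t q.1 →
      ∑ q ∈ S, c q - ∑ q ∈ S', c q ∈ interval p T)
    {r : ι → ℤ} (hrR : ∀ i, |r i| ≤ R) (hr : ∑ i, r i • t i = 0) :
    ∑ i, r i • c (i, 0) ∈ interval p ((1 + 2 * (Fintype.card ι * (R + 1))) * T) := by
  classical
  -- The positive and negative parts of `r` become two sets of copies with equal `t`-sums.
  -- Singletons `{q}` and `{(q.1, 0)}` also have equal sums, so each copy may be replaced by copy 0
  -- at cost `T`.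
  set S := initialPart R (fun i => (r i).toNat) with hS
  set S' := initialPart R (fun i => (-r i).toNat) with hS'
  have h1 : ∀ i, (r i).toNat ≤ R := fun i => by have := abs_le.1 (hrR i); omega
  have h2 : ∀ i, (-r i).toNat ≤ R := fun i => by have := abs_le.1 (hrR i); omega
  have key : ∀ {M : Type} [AddCommGroup M] (f : ι → M),
      ∑ q ∈ S, f q.1 - ∑ q ∈ S', f q.1 = ∑ i, r i • f i := by
    intro M _ f
    rw [sum_initialPart h1, sum_initialPart h2, ← Finset.sum_sub_distrib]
    refine Finset.sum_congr rfl fun i _ => ?_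
    rw [← natCast_zsmul, ← natCast_zsmul, ← sub_smul]
    congr 1
    omega
  have ht : ∑ q ∈ S, t q.1 = ∑ q ∈ S', t q.1 := by
    rw [← sub_eq_zero, key, hr]
  have hone : ∀ q : ι × Fin (R + 1), c q - c (q.1, 0) ∈ interval p T := fun q => by
    simpa using hc {q} {(q.1, 0)} (by simp)
  have hcard : ∀ U : Finset (ι × Fin (R + 1)), U.card * T ≤ (Fintype.card ι * (R + 1)) * T := by
    intro U
    gcongr
    simpa using U.card_le_univ
  have hmain := sub_mem_interval (sub_mem_interval (hc S S' ht)
    (interval_mono (hcard S) (sum_mem_interval S fun q _ => hone q)))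
    (neg_mem_interval (interval_mono (hcard S') (sum_mem_interval S' fun q _ => hone q)))
  rw [← key (fun i => c (i, 0))]
  simp only [Finset.sum_sub_distrib] at hmain
  have e1 : ∀ a b a' b' : ZMod p, a - b - (a - a') - -(b - b') = a' - b' := fun a b a' b' => by ring
  have e2 : T + Fintype.card ι * (R + 1) * T + Fintype.card ι * (R + 1) * T =
      (1 + 2 * (Fintype.card ι * (R + 1))) * T := by ring
  rwa [e1, e2] at hmain

/-- If `c : ι × Fin (R + 1) → 𝔽_p` respects the additive relations among the vectors `t i` up to
a bounded error, then it is at bounded distance from a linear function of `t i`. -/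
theorem exists_linear_approx (t : ι → Fin n → ℤ) :
    ∃ R C p₁ : ℕ, ∀ p : ℕ, p.Prime → p₁ < p → ∀ (T : ℕ) (c : ι × Fin (R + 1) → ZMod p),
      (∀ S S' : Finset (ι × Fin (R + 1)), ∑ q ∈ S, t q.1 = ∑ q ∈ S', t q.1 →
        ∑ q ∈ S, c q - ∑ q ∈ S', c q ∈ interval p T) →
      ∃ α : Fin n → ZMod p, ∀ i, c (i, 0) + ∑ k, α k * (t i k : ZMod p) ∈ interval p (C * T) := by
  classical
  set φ := Fintype.linearCombination ℤ t with hφ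
  -- The lattice spanned by the `t i` has a basis of multiples `a j` of members of a basis of `ℤ^n`.
  -- Once `p` exceeds all `|a j|` these are units mod `p`, so any homomorphism from the lattice to
  -- `𝔽_p` extends to `ℤ^n`.
  obtain ⟨k, snf⟩ := Submodule.smithNormalForm (Pi.basisFun ℤ (Fin n)) (LinearMap.range φ)
  have hg : ∀ j, ∃ g : ι → ℤ, φ g = snf.bN j := fun j => (snf.bN j).2
  choose g hg using hg
  have htmem : ∀ i, t i ∈ LinearMap.range φ := fun i =>
    ⟨Pi.single i 1, by simp [hφ, Fintype.linearCombination_apply_single]⟩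
  set ν : ι → Fin k → ℤ := fun i j => snf.bN.repr ⟨t i, htmem i⟩ j with hν
  have hexp : ∀ i, t i = ∑ j, ν i j • (snf.bN j : Fin n → ℤ) := fun i => by
    have := congrArg Subtype.val (snf.bN.sum_repr ⟨t i, htmem i⟩)
    rw [AddSubmonoidClass.coe_finsetSum] at this
    exact this.symm
  -- The relation expressing `t i` through the chosen preimages `g j` of the lattice basis. These
  -- finitely many relations do not depend on `p`, which makes `R` and `C` uniform.
  set r : ι → ι → ℤ := fun i => Pi.single i 1 - ∑ j, ν i j • g j with hrdef
  have hr0 : ∀ i, φ (r i) = 0 := fun i => by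
    rw [hrdef]
    simp only [map_sub, map_sum, map_smul, hg]
    rw [← hexp, hφ, Fintype.linearCombination_apply_single]
    simp
  refine ⟨∑ i, ∑ i', (r i i').natAbs,
    1 + 2 * (Fintype.card ι * (∑ i, ∑ i', (r i i').natAbs + 1)), ∑ j, (snf.a j).natAbs,
    fun p hp hlt T c hc => ?_⟩
  have := Fact.mk hp
  have ha : ∀ j, (snf.a j : ZMod p) ≠ 0 := by
    intro j h
    rw [ZMod.intCast_zmod_eq_zero_iff_dvd] at h
    have hne : snf.a j ≠ 0 := by
      intro h0
      have := snf.snf j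
      rw [h0, zero_smul] at this
      exact snf.bN.ne_zero j (Subtype.ext this)
    have h1 := Nat.le_of_dvd (Int.natAbs_pos.2 hne) (Int.natCast_dvd.1 h)
    have h2 : (snf.a j).natAbs ≤ ∑ j, (snf.a j).natAbs :=
      Finset.single_le_sum (f := fun j => (snf.a j).natAbs) (fun _ _ => Nat.zero_le _)
        (Finset.mem_univ j)
    omega
  set γ := Fintype.linearCombination ℤ (fun i => c (i, 0)) with hγ
  set β : Fin n → ZMod p := fun x =>
    if h : ∃ j, snf.f j = x then (snf.a h.choose : ZMod p)⁻¹ * γ (g h.choose) else 0 with hβ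
  have hβf : ∀ j, β (snf.f j) = (snf.a j : ZMod p)⁻¹ * γ (g j) := fun j => by
    have h : ∃ j', snf.f j' = snf.f j := ⟨j, rfl⟩
    have h' : h.choose = j := snf.f.injective h.choose_spec
    rw [hβ]
    simp only [dif_pos h]
    rw [h']
  set A : (Fin n → ℤ) →ₗ[ℤ] ZMod p := snf.bM.constr ℤ β with hA
  have hAbN : ∀ j, A (snf.bN j) = γ (g j) := fun j => by
    rw [snf.snf, map_smul, hA, Module.Basis.constr_basis, hβf, zsmul_eq_mul, ← mul_assoc,
      mul_inv_cancel₀ (ha j), one_mul]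
  have hAt : ∀ i, c (i, 0) - A (t i) = γ (r i) := fun i => by
    rw [hexp i, show r i = Pi.single i 1 - ∑ j, ν i j • g j from rfl]
    simp only [map_sub, map_sum, map_smul, hAbN]
    rw [hγ, Fintype.linearCombination_apply_single, one_smul]
  have hAcoord : ∀ x : Fin n → ℤ, A x = ∑ k, A (Pi.single k 1) * (x k : ZMod p) := fun x => by
    conv_lhs => rw [LinearMap.pi_apply_eq_sum_univ A x]
    refine Finset.sum_congr rfl fun k _ => ?_
    rw [zsmul_eq_mul, mul_comm]
    congr 3
    ext x
    simp [Pi.single_apply, eq_comm]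
  refine ⟨fun k => -A (Pi.single k 1), fun i => ?_⟩
  have hmem : ∑ i', r i i' • c (i', 0) ∈ interval p _ :=
    relation_mem_interval hc (r := r i) (fun i' => by
      have h1 : (r i i').natAbs ≤ ∑ i', (r i i').natAbs :=
        Finset.single_le_sum (f := fun i' => (r i i').natAbs) (fun _ _ => Nat.zero_le _)
          (Finset.mem_univ i')
      have h2 : ∑ i', (r i i').natAbs ≤ ∑ i, ∑ i', (r i i').natAbs :=
        Finset.single_le_sum (f := fun i => ∑ i', (r i i').natAbs) (fun _ _ => Nat.zero_le _)
          (Finset.mem_univ i)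
      rw [Int.abs_eq_natAbs]
      exact_mod_cast h1.trans h2) (by
      have := hr0 i
      rwa [hφ, Fintype.linearCombination_apply] at this)
  have heq : c (i, 0) + ∑ k, -A (Pi.single k 1) * (t i k : ZMod p) = ∑ i', r i i' • c (i', 0) := by
    have h := hAt i
    rw [hγ, Fintype.linearCombination_apply, hAcoord] at h
    rw [← h]
    simp [Finset.sum_neg_distrib, sub_eq_add_neg]
  rw [heq]
  exact hmem

end Relations

/-! ### Growth from Fourier analysis. -/

section Fourier

open Finset

variable {p m : ℕ} [Fact p.Prime]

/-- The number of elements that the translation by `v` moves out of `A`. -/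
def exitCount {G : Type*} [DecidableEq G] [Add G] (A : Finset G) (v : G) : ℕ :=
  (A.filter fun a => a + v ∉ A).card

/-- A point outside `A` after `j + 1` steps was outside after `j` steps or left at the last step;
points of the latter kind inject into the exits of `v`. -/
theorem exitCount_nsmul_le {G : Type*} [DecidableEq G] [AddCommGroup G] (A : Finset G) (v : G)
    (j : ℕ) : exitCount A (j • v) ≤ j * exitCount A v := by
  induction j with
  | zero => simp [exitCount]
  | succ j ih =>
    have hsub : (A.filter fun a => a + (j + 1) • v ∉ A) ⊆ (A.filter fun a => a + j • v ∉ A) ∪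
        (A.filter fun a => a + v ∉ A).image (fun a => a - j • v) := by
      intro a ha
      rw [mem_filter] at ha
      by_cases h : a + j • v ∈ A
      · refine mem_union_right _ (mem_image.2 ⟨a + j • v, mem_filter.2 ⟨h, ?_⟩, by abel⟩)
        rw [add_assoc, ← succ_nsmul]
        exact ha.2
      · exact mem_union_left _ (mem_filter.2 ⟨ha.1, h⟩)
    calc exitCount A ((j + 1) • v) ≤ _ := card_le_card hsub
      _ ≤ _ := card_union_le _ _
      _ ≤ j * exitCount A v + exitCount A v := add_le_add ih card_image_le
      _ = _ := by ring

theorem sum_stdAddChar_dotProduct (v : Fin m → ZMod p) :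
    ∑ x : Fin m → ZMod p, ZMod.stdAddChar (x ⬝ᵥ v) = if v = 0 then (p : ℂ) ^ m else 0 := by
  let ψ : AddChar (Fin m → ZMod p) ℂ :=
    { toFun := fun x => ZMod.stdAddChar (x ⬝ᵥ v)
      map_zero_eq_one' := by simp
      map_add_eq_mul' := fun x y => by rw [add_dotProduct, AddChar.map_add_eq_mul] }
  have hψ : ∀ x, ψ x = ZMod.stdAddChar (x ⬝ᵥ v) := fun _ => rfl
  split_ifs with h
  · subst h
    simp [ZMod.card]
  · simp only [← hψ]
    refine AddChar.sum_eq_zero_of_ne_one fun h1 => h ?_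
    rw [← dotProduct_eq_zero_iff]
    intro x
    have := DFunLike.congr_fun h1 x
    rw [hψ, AddChar.one_apply, ← AddChar.map_zero_eq_one (ZMod.stdAddChar (N := p))] at this
    rw [dotProduct_comm]
    exact ZMod.injective_stdAddChar this

/-- The squared absolute value of the Fourier transform of the indicator function of `A`. -/
noncomputable def energy (A : Finset (Fin m → ZMod p)) (x : Fin m → ZMod p) : ℝ :=
  ‖∑ a ∈ A, (ZMod.stdAddChar (x ⬝ᵥ a) : ℂ)‖ ^ 2

theorem energy_nonneg (A : Finset (Fin m → ZMod p)) (x : Fin m → ZMod p) : 0 ≤ energy A x := by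
  unfold energy
  positivity

theorem energy_zero (A : Finset (Fin m → ZMod p)) : energy A 0 = (A.card : ℝ) ^ 2 := by
  simp [energy]

theorem coe_energy (A : Finset (Fin m → ZMod p)) (x : Fin m → ZMod p) :
    (energy A x : ℂ) = ∑ a ∈ A, ∑ b ∈ A, (ZMod.stdAddChar (x ⬝ᵥ (a - b)) : ℂ) := by
  rw [energy, Complex.ofReal_pow, ← Complex.mul_conj', map_sum, sum_mul_sum]
  refine sum_congr rfl fun a _ => sum_congr rfl fun b _ => ?_
  rw [← AddChar.map_neg_eq_conj, ← AddChar.map_add_eq_mul, dotProduct_sub, sub_eq_add_neg]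

theorem sum_energy_mul (A : Finset (Fin m → ZMod p)) (v : Fin m → ZMod p) :
    ∑ x, energy A x * (ZMod.stdAddChar (x ⬝ᵥ v) : ℂ).re =
      (p : ℝ) ^ m * (A.filter fun a => a + v ∈ A).card := by
  have h : ∑ x, (energy A x : ℂ) * (ZMod.stdAddChar (x ⬝ᵥ v) : ℂ) =
      (p : ℂ) ^ m * (A.filter fun a => a + v ∈ A).card := by
    simp only [coe_energy, sum_mul, ← AddChar.map_add_eq_mul, ← dotProduct_add]
    rw [sum_comm]
    have : ∀ a ∈ A, ∑ x : Fin m → ZMod p, ∑ b ∈ A,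
        (ZMod.stdAddChar (x ⬝ᵥ (a - b + v)) : ℂ) = if a + v ∈ A then (p : ℂ) ^ m else 0 := by
      intro a _
      rw [sum_comm]
      simp only [sum_stdAddChar_dotProduct]
      have hb : ∀ b, a - b + v = 0 ↔ a + v = b := fun b => by
        rw [sub_add_eq_add_sub, sub_eq_zero]
      simp only [hb]
      rw [sum_ite_eq]
    rw [sum_congr rfl this, ← sum_filter, sum_const, nsmul_eq_mul, mul_comm]
  have := congrArg Complex.re h
  rw [Complex.re_sum] at this
  simp only [Complex.re_ofReal_mul] at this
  rw [this, ← Complex.ofReal_natCast, ← Complex.ofReal_pow, Complex.re_ofReal_mul]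
  simp

theorem sum_energy (A : Finset (Fin m → ZMod p)) :
    ∑ x, energy A x = (p : ℝ) ^ m * A.card := by
  simpa using sum_energy_mul A 0

/-- Writes the exits of `v` as a sum over frequencies with non-negative terms, so that frequencies
may be bounded or dropped separately. -/
theorem sum_energy_mul_one_sub (A : Finset (Fin m → ZMod p)) (v : Fin m → ZMod p) :
    ∑ x, energy A x * (1 - (ZMod.stdAddChar (x ⬝ᵥ v) : ℂ).re) = (p : ℝ) ^ m * exitCount A v := by
  simp only [mul_sub, mul_one, sum_sub_distrib]
  rw [sum_energy, sum_energy_mul, ← mul_sub, exitCount,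
    ← card_filter_add_card_filter_not (s := A) (fun a => a + v ∈ A)]
  push_cast
  ring

/-- The chord of angle `θ` has length `2 |sin (θ/2)|`, and `|sin y| ≥ 2 |y| / π` for `|y| ≤ π/2`. -/
theorem le_norm_stdAddChar_sub_one {K : ℕ} {x : ZMod p} (hx : x ∉ interval p K) :
    4 * (K : ℝ) / p ≤ ‖(ZMod.stdAddChar x : ℂ) - 1‖ := by
  have hp : (0 : ℝ) < p := by exact_mod_cast (Fact.out : p.Prime).pos
  have h1 := lt_abs_valMinAbs_of_notMem_interval hx
  set n := x.valMinAbs with hn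
  have h2 : (n.natAbs : ℝ) ≤ p / 2 := by
    have h := ZMod.natAbs_valMinAbs_le x
    have h' : n.natAbs * 2 ≤ p := by omega
    have : ((n.natAbs * 2 : ℕ) : ℝ) ≤ p := by exact_mod_cast h'
    push_cast at this
    linarith
  have h3 : |(n : ℝ)| ≤ p / 2 := by rwa [← Int.cast_abs, ← Nat.cast_natAbs]
  have h4 : (K : ℝ) ≤ |(n : ℝ)| := by exact_mod_cast h1.le
  have h5 : (ZMod.stdAddChar x : ℂ) = Complex.exp (Complex.I * ((2 * Real.pi * n / p : ℝ) : ℂ)) := by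
    conv_lhs => rw [← x.coe_valMinAbs, ZMod.stdAddChar_coe]
    congr 1
    push_cast
    ring
  have h6 : |2 * Real.pi * n / p / 2| = Real.pi * |(n : ℝ)| / p := by
    rw [show 2 * Real.pi * n / p / 2 = Real.pi * n / p by ring, abs_div, abs_mul,
      abs_of_pos Real.pi_pos, abs_of_pos hp]
  have h7 := Real.mul_abs_le_abs_sin (x := 2 * Real.pi * n / p / 2) (by
    rw [h6, div_le_iff₀ hp]
    nlinarith [Real.pi_pos])
  rw [h5, Complex.norm_exp_I_mul_ofReal_sub_one, norm_mul, Real.norm_eq_abs, Real.norm_eq_abs,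
    abs_two]
  have h8 : 2 / Real.pi * |2 * Real.pi * n / p / 2| = 2 * |(n : ℝ)| / p := by
    rw [h6]
    field_simp
  rw [h8] at h7
  calc 4 * (K : ℝ) / p ≤ 4 * |(n : ℝ)| / p := by gcongr
    _ = 2 * (2 * |(n : ℝ)| / p) := by ring
    _ ≤ _ := by gcongr

/-- The geometric sum of the character values is at most `2 / ‖z - 1‖ ≤ p / (2K) ≤ J / 2`. -/
theorem half_le_sum_one_sub_stdAddChar {K J : ℕ} (hK : 1 ≤ K) (hJ : p ≤ K * J) {x : ZMod p}
    (hx : x ∉ interval p K) :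
    (J : ℝ) / 2 ≤ ∑ j ∈ range J, (1 - (ZMod.stdAddChar (j • x) : ℂ).re) := by
  have hp : (0 : ℝ) < p := by exact_mod_cast (Fact.out : p.Prime).pos
  have hK' : (1 : ℝ) ≤ K := by exact_mod_cast hK
  have hJ' : (p : ℝ) ≤ K * J := by exact_mod_cast hJ
  have hz := le_norm_stdAddChar_sub_one hx
  set z : ℂ := ZMod.stdAddChar x with hzdef
  have hz1 : ‖z‖ = 1 := AddChar.norm_apply _ _
  have hpos : 0 < ‖z - 1‖ := lt_of_lt_of_le (by positivity) hz
  have hne : z ≠ 1 := fun h => by simp [h] at hpos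
  have hs : ‖∑ j ∈ range J, z ^ j‖ ≤ J / 2 := by
    rw [geom_sum_eq hne, norm_div, div_le_iff₀ hpos]
    calc ‖z ^ J - 1‖ ≤ ‖z ^ J‖ + ‖(1 : ℂ)‖ := norm_sub_le _ _
      _ = 2 := by rw [norm_pow, hz1]; norm_num
      _ ≤ J / 2 * (4 * K / p) := by
        rw [div_mul_div_comm, le_div_iff₀ (by positivity)]
        linarith
      _ ≤ _ := by gcongr
  have hre := (Complex.abs_re_le_norm _).trans hs
  rw [Complex.re_sum] at hre
  have := (abs_le.1 hre).2
  simp only [AddChar.map_nsmul_eq_pow, ← hzdef]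
  rw [sum_sub_distrib, sum_const, card_range, nsmul_eq_mul, mul_one]
  linarith

/-- If vectors `v q` with weights `ω q` are spread out along each non-zero linear functional, then
on the average the translation by `v q` moves many elements out of a set of density at most
one half. -/
theorem le_sum_exitCount {A : Finset (Fin m → ZMod p)} (hA : 2 * A.card ≤ p ^ m) {K : ℕ}
    (hK : 1 ≤ K) (hKp : K ≤ p) {Ω : Type*} (s : Finset Ω) {ω : Ω → ℝ} (hω : ∀ q ∈ s, 0 ≤ ω q)
    {v : Ω → Fin m → ZMod p} {φ : ℝ} (hφ : 0 ≤ φ) [∀ x : ZMod p, Decidable (x ∉ interval p K)]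
    (h : ∀ x : Fin m → ZMod p, x ≠ 0 → φ ≤ ∑ q ∈ s with x ⬝ᵥ v q ∉ interval p K, ω q) :
    φ * K * A.card ≤ 8 * p * ∑ q ∈ s, ω q * exitCount A (v q) := by
  have hp0 : 0 < p := (Fact.out : p.Prime).pos
  have hp : (0 : ℝ) < p := by exact_mod_cast hp0
  obtain ⟨J, hJ1, hJ2⟩ : ∃ J, p ≤ K * J ∧ K * J ≤ 2 * p := by
    refine ⟨p / K + 1, ?_, ?_⟩
    · have := Nat.lt_mul_div_succ p hK
      exact this.le
    · have := Nat.mul_div_le p K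
      rw [mul_add, mul_one]
      omega
  have hJpos : 0 < J := by
    rcases Nat.eq_zero_or_pos J with h0 | h0
    · subst h0; omega
    · exact h0
  have hJ0 : (0 : ℝ) < J := by exact_mod_cast hJpos
  have hpm : (0 : ℝ) < (p : ℝ) ^ m := by positivity
  set g : ZMod p → ℝ := fun y => ∑ j ∈ range J, (1 - (ZMod.stdAddChar (j • y) : ℂ).re) with hg
  have hg0 : ∀ y, 0 ≤ g y := fun y => sum_nonneg fun j _ => by
    have := (Complex.re_le_norm (ZMod.stdAddChar (j • y))).trans_eq (AddChar.norm_apply _ _)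
    linarith
  have hE := energy_nonneg A
  -- Testing the multiples `j • v` with `j < J ≈ p / K` magnifies the phase of `x ⬝ᵥ v`; each
  -- multiple costs at most a factor `J` in exits.
  have hupper : ∀ q, ∑ x, energy A x * g (x ⬝ᵥ v q) ≤ (p : ℝ) ^ m * (J ^ 2 * exitCount A (v q)) := by
    intro q
    simp only [hg, mul_sum]
    rw [sum_comm]
    simp only [← dotProduct_smul, sum_energy_mul_one_sub]
    rw [← mul_sum]
    gcongr
    calc ∑ j ∈ range J, (exitCount A (j • v q) : ℝ) ≤ ∑ j ∈ range J, (J * exitCount A (v q) : ℝ) := by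
          refine sum_le_sum fun j hj => ?_
          have h1 := exitCount_nsmul_le A (v q) j
          have h2 : j * exitCount A (v q) ≤ J * exitCount A (v q) :=
            Nat.mul_le_mul_right _ (mem_range.1 hj).le
          exact_mod_cast h1.trans h2
      _ = _ := by
        rw [sum_const, card_range, nsmul_eq_mul]
        ring
  have hlower : ∀ x ≠ 0, J / 2 * φ ≤ ∑ q ∈ s, ω q * g (x ⬝ᵥ v q) := by
    intro x hx
    calc J / 2 * φ ≤ J / 2 * ∑ q ∈ s with x ⬝ᵥ v q ∉ interval p K, ω q := by
          gcongr
          exact h x hx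
      _ = ∑ q ∈ s with x ⬝ᵥ v q ∉ interval p K, ω q * (J / 2) := by
        rw [mul_comm, sum_mul]
      _ ≤ ∑ q ∈ s with x ⬝ᵥ v q ∉ interval p K, ω q * g (x ⬝ᵥ v q) := by
        refine sum_le_sum fun q hq => ?_
        rw [mem_filter] at hq
        exact mul_le_mul_of_nonneg_left (half_le_sum_one_sub_stdAddChar hK hJ1 hq.2) (hω q hq.1)
      _ ≤ _ := sum_le_sum_of_subset_of_nonneg (filter_subset _ _)
        fun q hq _ => mul_nonneg (hω q hq) (hg0 _)
  -- Density at most 1/2 means that frequency zero carries at most half of the total energy.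
  have hmass : (p : ℝ) ^ m * A.card / 2 ≤ ∑ x ∈ univ.erase 0, energy A x := by
    have h1 := sum_erase_add univ (energy A) (mem_univ 0)
    rw [sum_energy, energy_zero] at h1
    have h2 : (2 : ℝ) * A.card ≤ (p : ℝ) ^ m := by exact_mod_cast hA
    nlinarith [Nat.cast_nonneg (α := ℝ) A.card]
  have hmain : (p : ℝ) ^ m * A.card / 2 * (J / 2 * φ) ≤
      (p : ℝ) ^ m * (J ^ 2 * ∑ q ∈ s, ω q * exitCount A (v q)) := by
    calc (p : ℝ) ^ m * A.card / 2 * (J / 2 * φ)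
        ≤ (∑ x ∈ univ.erase 0, energy A x) * (J / 2 * φ) := by gcongr
      _ = ∑ x ∈ univ.erase 0, energy A x * (J / 2 * φ) := sum_mul _ _ _
      _ ≤ ∑ x ∈ univ.erase 0, energy A x * ∑ q ∈ s, ω q * g (x ⬝ᵥ v q) :=
        sum_le_sum fun x hx => mul_le_mul_of_nonneg_left (hlower x (ne_of_mem_erase hx)) (hE x)
      _ ≤ ∑ x, energy A x * ∑ q ∈ s, ω q * g (x ⬝ᵥ v q) :=
        sum_le_sum_of_subset_of_nonneg (erase_subset _ _) fun x _ _ =>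
          mul_nonneg (hE x) (sum_nonneg fun q hq => mul_nonneg (hω q hq) (hg0 _))
      _ = ∑ q ∈ s, ω q * ∑ x, energy A x * g (x ⬝ᵥ v q) := by
        simp only [mul_sum]
        rw [sum_comm]
        exact sum_congr rfl fun q _ => sum_congr rfl fun x _ => by ring
      _ ≤ ∑ q ∈ s, ω q * ((p : ℝ) ^ m * (J ^ 2 * exitCount A (v q))) :=
        sum_le_sum fun q hq => mul_le_mul_of_nonneg_left (hupper q) (hω q hq)
      _ = _ := by
        simp only [mul_sum]
        exact sum_congr rfl fun q _ => by ring
  set Q := ∑ q ∈ s, ω q * (exitCount A (v q) : ℝ) with hQ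
  have hQ0 : 0 ≤ Q := sum_nonneg fun q hq => mul_nonneg (hω q hq) (Nat.cast_nonneg _)
  have h1 : φ * A.card ≤ 4 * (J * Q) := by
    have : (p : ℝ) ^ m * J * (φ * A.card) ≤ (p : ℝ) ^ m * J * (4 * (J * Q)) := by linarith
    exact le_of_mul_le_mul_left this (by positivity)
  have h2 : ((K * J : ℕ) : ℝ) ≤ ((2 * p : ℕ) : ℝ) := by exact_mod_cast hJ2
  push_cast at h2
  calc φ * K * A.card = K * (φ * A.card) := by ring
    _ ≤ K * (4 * (J * Q)) := by gcongr
    _ = 4 * (K * J) * Q := by ring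
    _ ≤ 4 * (2 * p) * Q := by gcongr
    _ = _ := by ring

end Fourier

/-! ### Isoperimetry on the discrete torus. -/

section Isoperimetry

open Finset MeasureTheory
open scoped ENNReal

variable {p m : ℕ} [Fact p.Prime]

/-- The density on `𝔽_p^m` that puts mass one on each boundary point of `A` in each direction,
and mass `m / p` on each element of `A`. -/
noncomputable def boundaryDensity (A : Finset (Fin m → ZMod p)) (x : Fin m → ZMod p) : ℝ≥0∞ :=
  ∑ i, ((if x ∉ A ∧ x - Pi.single i 1 ∈ A then 1 else 0) + (if x ∈ A then (p : ℝ≥0∞)⁻¹ else 0))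

theorem sum_boundaryDensity (A : Finset (Fin m → ZMod p)) :
    ∑ x, boundaryDensity A x =
      ∑ i : Fin m, (exitCount A (Pi.single i 1) : ℝ≥0∞) + m * (A.card * (p : ℝ≥0∞)⁻¹) := by
  unfold boundaryDensity
  rw [sum_comm]
  have h : ∀ i : Fin m, ∑ x, ((if x ∉ A ∧ x - Pi.single i 1 ∈ A then (1 : ℝ≥0∞) else 0) +
      (if x ∈ A then (p : ℝ≥0∞)⁻¹ else 0)) =
      exitCount A (Pi.single i 1) + A.card * (p : ℝ≥0∞)⁻¹ := by
    intro i
    rw [sum_add_distrib, ← sum_filter, ← sum_filter, sum_const, sum_const, nsmul_eq_mul,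
      nsmul_eq_mul, mul_one, filter_mem_eq_inter, univ_inter, exitCount]
    congr 2
    refine card_nbij' (fun x => x - Pi.single i 1) (fun x => x + Pi.single i 1) ?_ ?_ ?_ ?_
    · intro x hx
      simpa [and_comm] using hx
    · intro x hx
      simpa [and_comm] using hx
    · intro x _
      simp
    · intro x _
      simp
  rw [sum_congr rfl fun i _ => h i, sum_add_distrib, sum_const, card_univ, Fintype.card_fin,
    nsmul_eq_mul]

/-- If the line through `x` in direction `i` lies in `A`, its `p` points have mass at least `1 / p`
each; otherwise, going round the cycle, it leaves `A` at a boundary point of mass at least one. -/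
theorem one_le_sum_boundaryDensity {A : Finset (Fin m → ZMod p)} {x : Fin m → ZMod p}
    (hx : x ∈ A) (i : Fin m) : 1 ≤ ∑ y, boundaryDensity A (Function.update x i y) := by
  have hp : p ≠ 0 := (Fact.out : p.Prime).ne_zero
  by_cases hall : ∀ y, Function.update x i y ∈ A
  · calc (1 : ℝ≥0∞) = ∑ _y : ZMod p, (p : ℝ≥0∞)⁻¹ := by
          rw [sum_const, card_univ, ZMod.card, nsmul_eq_mul, ENNReal.mul_inv_cancel]
          · exact_mod_cast hp
          · exact ENNReal.natCast_ne_top p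
      _ ≤ _ := by
        refine sum_le_sum fun y _ => ?_
        unfold boundaryDensity
        refine le_trans ?_ (single_le_sum (fun _ _ => zero_le) (mem_univ i))
        rw [if_pos (hall y)]
        exact le_add_self
  · obtain ⟨y, hy, hy'⟩ : ∃ y, Function.update x i y ∈ A ∧ Function.update x i (y + 1) ∉ A := by
      by_contra! hcon
      refine hall fun y => ?_
      have hnat : ∀ k : ℕ, Function.update x i (x i + k) ∈ A := by
        intro k
        induction k with
        | zero => simpa using hx
        | succ k ih =>
          have := hcon _ ih
          push_cast
          rwa [← add_assoc]
      have := hnat (y - x i).val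
      rwa [ZMod.natCast_zmod_val, add_sub_cancel] at this
    have hsub : Function.update x i (y + 1) - Pi.single i 1 = Function.update x i y := by
      ext k
      by_cases hk : k = i
      · subst hk
        simp
      · simp [hk]
    calc (1 : ℝ≥0∞) ≤ boundaryDensity A (Function.update x i (y + 1)) := by
          unfold boundaryDensity
          refine le_trans ?_ (single_le_sum (fun _ _ => zero_le) (mem_univ i))
          rw [hsub, if_pos ⟨hy', hy⟩]
          exact le_self_add
      _ ≤ _ := single_le_sum (f := fun y => boundaryDensity A (Function.update x i y))
        (fun _ _ => zero_le) (mem_univ (y + 1))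

/-- An isoperimetric inequality of Loomis–Whitney type on the torus `𝔽_p^m`. -/
theorem card_pow_le_boundary_pow (hm : 1 ≤ m) {A : Finset (Fin m → ZMod p)} (hA : A.Nonempty) :
    (A.card : ℝ) ^ (m - 1) ≤
      (∑ i : Fin m, (exitCount A (Pi.single i 1) : ℝ) + m * (A.card / p)) ^ m := by
  have hp : (p : ℝ≥0∞) ≠ 0 := by exact_mod_cast (Fact.out : p.Prime).ne_zero
  set U : ℝ := ∑ i : Fin m, (exitCount A (Pi.single i 1) : ℝ) + m * (A.card / p) with hU
  have hU0 : 0 ≤ U := by positivity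
  have hUS : ∑ x, boundaryDensity A x = ENNReal.ofReal U := by
    rw [sum_boundaryDensity, hU, ENNReal.ofReal_add (by positivity) (by positivity),
      ENNReal.ofReal_sum_of_nonneg (fun _ _ => by positivity), ENNReal.ofReal_mul (by positivity),
      ENNReal.ofReal_div_of_pos (by exact_mod_cast (Fact.out : p.Prime).pos)]
    simp only [ENNReal.ofReal_natCast, div_eq_mul_inv]
  rcases hm.eq_or_lt with rfl | hm2
  · obtain ⟨x, hx⟩ := hA
    have h1 := one_le_sum_boundaryDensity hx 0
    have h2 : ∑ y, boundaryDensity A (Function.update x 0 y) ≤ ∑ x, boundaryDensity A x := by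
      rw [← sum_image (f := boundaryDensity A) (g := fun y => Function.update x 0 y)
        (s := univ) (fun a _ b _ h => Function.update_injective x 0 h)]
      exact sum_le_sum_of_subset (subset_univ _)
    have h3 := h1.trans h2
    rw [hUS, ENNReal.one_le_ofReal] at h3
    simpa using h3
  · let _ : MeasurableSpace (ZMod p) := ⊤
    have : MeasurableSingletonClass (ZMod p) := ⟨fun _ => trivial⟩
    have hm1 : (1 : ℝ) < m := by exact_mod_cast hm2
    have hconj : Real.HolderConjugate (Fintype.card (Fin m)) (Real.conjExponent m) := by
      rw [Fintype.card_fin]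
      exact Real.HolderConjugate.conjExponent hm1
    -- With counting measure, the sum over `x` of the product of line sums to the power `1/(m-1)` is
    -- at most the total mass to the power `m/(m-1)`. Each point of `A` contributes at least 1 to
    -- the former. The exponents force `m > 1`, hence the separate case `m = 1`.
    have key := lintegral_prod_lintegral_pow_le (fun _ : Fin m => (Measure.count : Measure (ZMod p)))
      hconj (f := boundaryDensity A) (measurable_of_finite _)
    have hpi : ∀ x : Fin m → ZMod p,
        Measure.pi (fun _ : Fin m => (Measure.count : Measure (ZMod p))) {x} = 1 := fun x => by
      rw [Measure.pi_singleton]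
      simp
    simp only [lintegral_fintype, hpi, Measure.count_singleton, mul_one, hUS] at key
    have hlow : (A.card : ℝ≥0∞) ≤ ∑ x, ∏ i, (∑ y, boundaryDensity A (Function.update x i y)) ^
        ((1 : ℝ) / (Fintype.card (Fin m) - 1 : ℝ)) := by
      calc (A.card : ℝ≥0∞) = ∑ x ∈ A, 1 := by simp
        _ ≤ ∑ x ∈ A, ∏ i, (∑ y, boundaryDensity A (Function.update x i y)) ^
            ((1 : ℝ) / (Fintype.card (Fin m) - 1 : ℝ)) := by
          refine sum_le_sum fun x hx => ?_
          refine Finset.one_le_prod' fun i _ => ?_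
          refine ENNReal.one_le_rpow (one_le_sum_boundaryDensity hx i) ?_
          rw [Fintype.card_fin]
          have : (0 : ℝ) < m - 1 := by linarith
          positivity
        _ ≤ _ := sum_le_sum_of_subset (subset_univ _)
    have h := hlow.trans key
    rw [ENNReal.ofReal_rpow_of_nonneg hU0 (by
      unfold Real.conjExponent
      have : (0 : ℝ) < m - 1 := by linarith
      positivity), ← ENNReal.ofReal_natCast, ENNReal.ofReal_le_ofReal_iff (by positivity)] at h
    calc (A.card : ℝ) ^ (m - 1) ≤ (U ^ (Real.conjExponent m)) ^ (m - 1) := by gcongr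
      _ = U ^ m := by
        rw [← Real.rpow_natCast, ← Real.rpow_mul hU0, ← Real.rpow_natCast U m]
        congr 1
        unfold Real.conjExponent
        rw [Nat.cast_sub hm]
        have : (m : ℝ) - 1 ≠ 0 := by linarith
        push_cast
        field_simp

/-- A set of at most `(p / 2m)^m` elements has a large boundary in some direction. -/
theorem exists_le_exitCount_single (hm : 1 ≤ m) {A : Finset (Fin m → ZMod p)} {x : ℝ} (hx : 0 < x)
    (hxA : x ^ m = A.card) (hxp : 2 * m * x ≤ p) :
    ∃ i : Fin m, x ^ (m - 1) / (2 * m) ≤ exitCount A (Pi.single i 1) := by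
  by_contra! hcon
  have hp : (0 : ℝ) < p := by exact_mod_cast (Fact.out : p.Prime).pos
  have hm0 : (0 : ℝ) < m := by exact_mod_cast hm
  have hA : A.Nonempty := by
    rw [← card_pos]
    have : (0 : ℝ) < A.card := by rw [← hxA]; positivity
    exact_mod_cast this
  have h := card_pow_le_boundary_pow hm hA
  have : Nonempty (Fin m) := ⟨⟨0, hm⟩⟩
  have h1 : ∑ i : Fin m, (exitCount A (Pi.single i 1) : ℝ) < x ^ (m - 1) / 2 := by
    calc _ < ∑ _i : Fin m, x ^ (m - 1) / (2 * m) :=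
          sum_lt_sum_of_nonempty univ_nonempty fun i _ => hcon i
      _ = _ := by
        rw [sum_const, card_univ, Fintype.card_fin, nsmul_eq_mul]
        field_simp
  -- Here `2 * m * x ≤ p` is needed: the mass inside `A` must not account for more than half of the
  -- bound.
  have h2 : m * ((A.card : ℝ) / p) ≤ x ^ (m - 1) / 2 := by
    rw [← hxA, ← mul_div_assoc, div_le_div_iff₀ hp two_pos, ← mul_pow_sub_one (by omega : m ≠ 0) x]
    have : 0 < x ^ (m - 1) := by positivity
    nlinarith
  have h3 : (∑ i : Fin m, (exitCount A (Pi.single i 1) : ℝ) + m * (A.card / p)) ^ m <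
      (x ^ (m - 1)) ^ m := by
    refine pow_lt_pow_left₀ (by linarith) (by positivity) (by omega)
  rw [← pow_mul, mul_comm (m - 1), pow_mul, hxA] at h3
  linarith

end Isoperimetry

/-! ### Moves and how they combine. -/

section Moves

open Finset

variable {E G H : Type*} [AddCommGroup G] [AddCommGroup H]

/-- All elements of `A` are sums of `val` over subsets of `F`, on which `s` has the same sum. -/
def Realizes (s : E → H) (val : E → G) (F : Finset E) (A : Finset G) : Prop :=
  ∃ t₀, ∀ a ∈ A, ∃ S ⊆ F, ∑ i ∈ S, s i = t₀ ∧ ∑ i ∈ S, val i = a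

/-- The vector `v` is the difference of two sums of `val` over subsets of `F`, on which `s` has
the same sum. -/
def IsMove (s : E → H) (val : E → G) (F : Finset E) (v : G) : Prop :=
  ∃ S ⊆ F, ∃ S' ⊆ F, ∑ i ∈ S, s i = ∑ i ∈ S', s i ∧ ∑ i ∈ S, val i - ∑ i ∈ S', val i = v

theorem realizes_empty (s : E → H) (val : E → G) : Realizes s val ∅ {0} :=
  ⟨0, fun a ha => ⟨∅, subset_rfl, by simp, by simpa using (mem_singleton.1 ha).symm⟩⟩

variable [DecidableEq E]

/-- Adjoining `S'` to every realizing set translates `A` by `w`; adjoining `S` instead, for those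
`a` that exit, gives the new points `a + v + w` with the same `s`-sum. -/
theorem Realizes.exists_of_isMove [DecidableEq G] {s : E → H} {val : E → G} {F F' : Finset E} {A : Finset G} {v : G}
    (hA : Realizes s val F A) (hd : Disjoint F F') (hv : IsMove s val F' v) :
    ∃ A', Realizes s val (F ∪ F') A' ∧ A'.card = A.card + exitCount A v := by
  obtain ⟨t₀, ht₀⟩ := hA
  obtain ⟨S, hS, S', hS', hs, rfl⟩ := hv
  set v := ∑ i ∈ S, val i - ∑ i ∈ S', val i with hv
  set w := ∑ i ∈ S', val i with hw
  refine ⟨(A ∪ (A.filter fun a => a + v ∉ A).image (· + v)).image (· + w),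
    ⟨t₀ + ∑ i ∈ S', s i, ?_⟩, ?_⟩
  · intro a ha
    obtain ⟨b, hb, rfl⟩ := mem_image.1 ha
    rcases mem_union.1 hb with hb | hb
    · obtain ⟨U, hU, hU1, hU2⟩ := ht₀ b hb
      have hUd : Disjoint U S' := disjoint_of_subset_left hU (disjoint_of_subset_right hS' hd)
      exact ⟨U ∪ S', union_subset_union hU hS', by rw [sum_union hUd, hU1],
        by rw [sum_union hUd, hU2]⟩
    · obtain ⟨c, hc, rfl⟩ := mem_image.1 hb
      obtain ⟨U, hU, hU1, hU2⟩ := ht₀ c (mem_filter.1 hc).1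
      have hUd : Disjoint U S := disjoint_of_subset_left hU (disjoint_of_subset_right hS hd)
      exact ⟨U ∪ S, union_subset_union hU hS, by rw [sum_union hUd, hU1, hs],
        by rw [sum_union hUd, hU2, hv, add_assoc, sub_add_cancel]⟩
  · rw [card_image_of_injective _ (add_left_injective w), card_union_of_disjoint,
      card_image_of_injective _ (add_left_injective v), exitCount]
    rw [disjoint_left]
    intro a ha ha'
    obtain ⟨c, hc, rfl⟩ := mem_image.1 ha'
    exact (mem_filter.1 hc).2 ha

theorem Realizes.add {s : E → H} {val : E → G} {F F' : Finset E} {A A' : Finset G}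
    (hA : Realizes s val F A) (hA' : Realizes s val F' A') (hd : Disjoint F F') :
    ∃ t₀, ∀ a ∈ A, ∀ a' ∈ A', ∃ S : Finset E,
      ∑ i ∈ S, s i = t₀ ∧ ∑ i ∈ S, val i = a + a' := by
  obtain ⟨t₀, ht₀⟩ := hA
  obtain ⟨t₁, ht₁⟩ := hA'
  refine ⟨t₀ + t₁, fun a ha a' ha' => ?_⟩
  obtain ⟨U, hU, hU1, hU2⟩ := ht₀ a ha
  obtain ⟨V, hV, hV1, hV2⟩ := ht₁ a' ha'
  have hUd : Disjoint U V := disjoint_of_subset_left hU (disjoint_of_subset_right hV hd)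
  exact ⟨U ∪ V, by rw [sum_union hUd, hU1, hV1], by rw [sum_union hUd, hU2, hV2]⟩

/-- If moves supported off any small set of elements increase the number of sums in a controlled
way, then such moves can be combined. -/
theorem Realizes.iterate [DecidableEq G] {s : E → H} {val : E → G} {L B : ℕ} {Q : ℕ → ℕ → Prop}
    (hstep : ∀ k (A : Finset G) (U : Finset E), U.card ≤ L → Q k A.card → Q (k + 1) A.card ∨
      ∃ F v, Disjoint U F ∧ F.card ≤ B ∧ IsMove s val F v ∧ Q (k + 1) (A.card + exitCount A v))
    {F₀ U : Finset E} {A₀ : Finset G} (h₀ : Realizes s val F₀ A₀) (hd : Disjoint U F₀)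
    (hQ : Q 0 A₀.card) (k : ℕ) (hk : U.card + F₀.card + k * B ≤ L) :
    ∃ F A, Disjoint U F ∧ F.card ≤ F₀.card + k * B ∧ Realizes s val F A ∧ Q k A.card := by
  induction k with
  | zero => exact ⟨F₀, A₀, hd, by simp, h₀, hQ⟩
  | succ k ih =>
    rw [add_mul, one_mul] at hk
    obtain ⟨F, A, hUF, hF, hA, hQA⟩ := ih (by omega)
    rcases hstep k A (U ∪ F) ((card_union_le _ _).trans (by omega)) hQA with h | ⟨F', v, h1, h2, h3, h4⟩
    · exact ⟨F, A, hUF, by rw [add_mul]; omega, hA, h⟩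
    · rw [disjoint_union_left] at h1
      obtain ⟨A', hA', hcard⟩ := hA.exists_of_isMove h1.2 h3
      refine ⟨F ∪ F', A', disjoint_union_right.2 ⟨hUF, h1.1⟩, (card_union_le _ _).trans ?_, hA', ?_⟩
      · rw [add_mul]
        omega
      · rwa [hcard]

end Moves

/-! ### Growth of the set of sums under iterated moves. -/

section Growth

open Finset

theorem one_add_pow_le {y : ℝ} (hy0 : 0 ≤ y) (hy1 : y ≤ 1) (m : ℕ) :
    (1 + y) ^ m ≤ 1 + (2 ^ m - 1) * y := by
  induction m with
  | zero => simp
  | succ k ih =>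
    have h2 : (1 : ℝ) ≤ 2 ^ k := one_le_pow₀ one_le_two
    calc (1 + y) ^ (k + 1) = (1 + y) ^ k * (1 + y) := pow_succ _ _
      _ ≤ (1 + (2 ^ k - 1) * y) * (1 + y) := by gcongr
      _ ≤ _ := by
        rw [pow_succ]
        nlinarith [mul_nonneg (mul_nonneg (sub_nonneg.2 h2) hy0) (sub_nonneg.2 hy1)]

/-- The isoperimetric gain raises the `m`-th root `x` of the cardinality by at least `1 / C`, so `k`
moves raise it by `k / C`. -/
theorem add_pow_le_pow_add {x C : ℝ} {m : ℕ} (hm : 1 ≤ m) (hx : 1 ≤ x) (hC : C = 2 * m * 2 ^ m) :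
    (x + 1 / C) ^ m ≤ x ^ m + x ^ (m - 1) / (2 * m) := by
  have hm0 : (1 : ℝ) ≤ m := by exact_mod_cast hm
  have h2 : (1 : ℝ) ≤ 2 ^ m := one_le_pow₀ one_le_two
  have hC1 : 1 ≤ C := by rw [hC]; nlinarith
  have hx0 : 0 < x := by linarith
  have hy0 : 0 ≤ 1 / (C * x) := by positivity
  have hy1 : 1 / (C * x) ≤ 1 := by
    rw [div_le_one (by positivity)]
    nlinarith
  have h := one_add_pow_le hy0 hy1 m
  calc (x + 1 / C) ^ m = x ^ m * (1 + 1 / (C * x)) ^ m := by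
        rw [← mul_pow]
        congr 1
        field_simp
    _ ≤ x ^ m * (1 + 2 ^ m * (1 / (C * x))) := by
      gcongr
      linarith
    _ = x ^ m + x ^ (m - 1) / (2 * m) := by
      rw [hC, ← mul_pow_sub_one (by omega : m ≠ 0) x]
      field_simp

variable {E H : Type*} [DecidableEq E] [AddCommGroup H] {p m : ℕ} [Fact p.Prime]

/-- If moves supported off any set of at most `L` elements span `𝔽_p^m`, then combining `k ≤ p`
of them one gets at least `c k^m` sums. -/
theorem exists_realizes_pow {s : E → H} {val : E → Fin m → ZMod p} {L B : ℕ} (hm : 1 ≤ m)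
    (hspan : ∀ U : Finset E, U.card ≤ L →
      Submodule.span (ZMod p) {v | ∃ F, Disjoint U F ∧ F.card ≤ B ∧ IsMove s val F v} = ⊤)
    {U : Finset E} {k : ℕ} (hkp : k ≤ p) (hk : U.card + k * B ≤ L) :
    ∃ F A, Disjoint U F ∧ F.card ≤ k * B ∧ Realizes s val F A ∧
      ((k : ℝ) / (2 * m * 2 ^ m)) ^ m ≤ A.card := by
  have hm0 : (0 : ℝ) < m := by exact_mod_cast hm
  set C : ℝ := 2 * m * 2 ^ m with hC
  have hC0 : 0 < C := by positivity
  set Q : ℕ → ℕ → Prop := fun k a => k ≤ p → ((k : ℝ) / C) ^ m ≤ a ∧ 1 ≤ a with hQ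
  have hstep : ∀ k (A : Finset (Fin m → ZMod p)) (U : Finset E), U.card ≤ L → Q k A.card →
      Q (k + 1) A.card ∨ ∃ F v, Disjoint U F ∧ F.card ≤ B ∧ IsMove s val F v ∧
        Q (k + 1) (A.card + exitCount A v) := by
    intro k A U hU hA
    by_cases hkp : k + 1 ≤ p
    swap
    · exact Or.inl fun h => absurd h hkp
    obtain ⟨hA1, hA2⟩ := hA (by omega)
    have hA2' : (1 : ℝ) ≤ A.card := by exact_mod_cast hA2
    obtain ⟨x, hx0, hxA⟩ : ∃ x : ℝ, 0 ≤ x ∧ x ^ m = A.card :=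
      ⟨(A.card : ℝ) ^ (m⁻¹ : ℝ), by positivity, Real.rpow_inv_natCast_pow (by positivity) (by omega)⟩
    have hx1 : 1 ≤ x := by
      by_contra! hlt
      have := pow_lt_one₀ hx0 hlt (by omega : m ≠ 0)
      linarith
    have hkx : (k : ℝ) / C ≤ x := by
      rw [← hxA] at hA1
      exact (pow_le_pow_iff_left₀ (by positivity) hx0 (by omega)).1 hA1
    by_cases hxp : 2 * m * x ≤ p
    · right
      -- A basis made of moves; in its coordinates the moves are the unit vectors, to which the
      -- isoperimetric inequality applies.
      set b := Module.Basis.ofSpan (hspan U hU).ge with hb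
      have hcardb : Module.finrank (ZMod p) (Fin m → ZMod p) = m := by simp
      have hfin := Module.Finite.finite_basis b
      let b' := b.reindex (Finite.equivFinOfCardEq (n := m) (by
        rw [← Module.finrank_eq_nat_card_basis b, hcardb]))
      have hb' : ∀ i, ∃ F, Disjoint U F ∧ F.card ≤ B ∧ IsMove s val F (b' i) := fun i => by
        have : b' i ∈ Set.range b := by
          rw [← b.range_reindex]
          exact ⟨i, rfl⟩
        exact Module.Basis.ofSpan_subset (hspan U hU).ge this
      have hcard : ∀ i, exitCount (A.image b'.equivFun) (Pi.single i 1) = exitCount A (b' i) := by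
        intro i
        unfold exitCount
        rw [filter_image, card_image_of_injective _ b'.equivFun.injective]
        congr 1
        refine filter_congr fun a _ => ?_
        have hsingle : b'.equivFun (b' i) = Pi.single i 1 := by
          ext j
          rw [b'.equivFun_self, Pi.single_apply]
          simp only [eq_comm]
        rw [← hsingle, ← map_add, b'.equivFun.injective.mem_finset_image]
      obtain ⟨i, hi⟩ := exists_le_exitCount_single hm (A := A.image b'.equivFun) (x := x)
        (by linarith) (by rw [hxA, card_image_of_injective _ b'.equivFun.injective]) hxp
      obtain ⟨F, hF1, hF2, hF3⟩ := hb' i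
      refine ⟨F, b' i, hF1, hF2, hF3, fun _ => ⟨?_, by omega⟩⟩
      rw [hcard] at hi
      calc (((k + 1 : ℕ) : ℝ) / C) ^ m ≤ (x + 1 / C) ^ m := by
            gcongr
            push_cast
            rw [add_div]
            linarith
        _ ≤ x ^ m + x ^ (m - 1) / (2 * m) := add_pow_le_pow_add hm hx1 hC
        _ ≤ _ := by
          push_cast
          rw [hxA]
          linarith
    -- Now `x > p / (2m)`, which already exceeds the target `(k + 1) / C` because `k + 1 ≤ p`.
    · left
      refine fun _ => ⟨?_, hA2⟩
      rw [← hxA]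
      gcongr
      rw [div_le_iff₀ hC0]
      have h1 : ((k + 1 : ℕ) : ℝ) ≤ p := by exact_mod_cast hkp
      have h2 : (1 : ℝ) ≤ 2 ^ m := one_le_pow₀ one_le_two
      have h3 : 0 ≤ 2 * m * x := by positivity
      rw [hC]
      nlinarith
  obtain ⟨F, A, h1, h2, h3, h4⟩ := Realizes.iterate hstep (realizes_empty s val)
    (disjoint_empty_right U) (fun _ => ⟨by simp [zero_pow (by omega : m ≠ 0)], by simp⟩) k (by simpa using hk)
  exact ⟨F, A, h1, by simpa using h2, h3, (h4 hkp).1⟩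

/-- If moves supported off any set of at most `L` elements span `𝔽_p^m` and increase every set of
density at most one half by a factor `1 + ρ`, then combining `2 k` of them one gets more than
half of `𝔽_p^m`, provided that `k` is large. -/
theorem exists_realizes_half {s : E → H} {val : E → Fin m → ZMod p} {L B : ℕ} {ρ : ℝ} (hm : 1 ≤ m)
    (hρ : 0 ≤ ρ)
    (hspan : ∀ U : Finset E, U.card ≤ L →
      Submodule.span (ZMod p) {v | ∃ F, Disjoint U F ∧ F.card ≤ B ∧ IsMove s val F v} = ⊤)
    (hgrow : ∀ U : Finset E, U.card ≤ L → ∀ A : Finset (Fin m → ZMod p), 2 * A.card ≤ p ^ m →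
      ∃ F v, Disjoint U F ∧ F.card ≤ B ∧ IsMove s val F v ∧ ρ * A.card ≤ exitCount A v)
    {U : Finset E} {k : ℕ} (hkp : k ≤ p) (hk : U.card + 2 * (k * B) ≤ L)
    (hkρ : (p : ℝ) ^ m < 2 * (((k : ℝ) / (2 * m * 2 ^ m)) ^ m * (1 + k * ρ))) :
    ∃ F A, Disjoint U F ∧ F.card ≤ 2 * (k * B) ∧ Realizes s val F A ∧ p ^ m < 2 * A.card := by
  obtain ⟨F₁, A₁, h1, h2, h3, h4⟩ := exists_realizes_pow hm hspan hkp (by omega : U.card + k * B ≤ L)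
  -- Each gain `ρ * A.card` is only bounded below by `ρ * A₁.card`: linear growth from a set of
  -- positive density suffices.
  set Q : ℕ → ℕ → Prop := fun k a => p ^ m < 2 * a ∨ (A₁.card : ℝ) * (1 + k * ρ) ≤ a with hQ
  have hstep : ∀ k (A : Finset (Fin m → ZMod p)) (U : Finset E), U.card ≤ L → Q k A.card →
      Q (k + 1) A.card ∨ ∃ F v, Disjoint U F ∧ F.card ≤ B ∧ IsMove s val F v ∧
        Q (k + 1) (A.card + exitCount A v) := by
    intro k A U hU hA
    by_cases hhalf : p ^ m < 2 * A.card
    · exact Or.inl (Or.inl hhalf)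
    right
    obtain ⟨F, v, hF1, hF2, hF3, hF4⟩ := hgrow U hU A (not_lt.1 hhalf)
    refine ⟨F, v, hF1, hF2, hF3, Or.inr ?_⟩
    have hA' := hA.resolve_left hhalf
    have h5 : (A₁.card : ℝ) ≤ A.card := by
      have : 0 ≤ (A₁.card : ℝ) * (k * ρ) := by positivity
      linarith
    have h6 : (A₁.card : ℝ) * ρ ≤ ρ * A.card := by
      rw [mul_comm]
      gcongr
    push_cast
    linarith
  obtain ⟨F, A, h5, h6, h7, h8⟩ := Realizes.iterate hstep h3 h1
    (Or.inr (by simp)) k (by omega)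
  refine ⟨F, A, h5, by omega, h7, h8.elim id fun h8 => ?_⟩
  have : (p : ℝ) ^ m < 2 * A.card := by
    refine hkρ.trans_le ?_
    gcongr
    exact le_trans (by gcongr) h8
  exact_mod_cast this

end Growth

/-! ### Moves from thickness. -/

section Spread

open Finset

variable {ι E : Type*} {n m p : ℕ}

open Classical in
/-- A family of vectors `val a`, where `a` is of type `τ a`, is thick along every function of the
form `ξ + α ∘ t ∘ τ` with a non-zero linear part `ξ`. -/
def SpreadOut [Fintype E] (t : ι → Fin n → ℤ) (τ : E → ι) (val : E → Fin m → ZMod p) (K : ℕ) (δ : ℝ) : Prop :=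
  ∀ x : Fin m → ZMod p, x ≠ 0 → ∀ α : Fin n → ZMod p, δ * Fintype.card E ≤
    (univ.filter fun a => x ⬝ᵥ val a + ∑ k, α k * (t (τ a) k : ZMod p) ∉ interval p K).card

variable {t : ι → Fin n → ℤ} {τ : E → ι} {val : E → Fin m → ZMod p}

/-- Injectively chosen reference elements: `R + 1` elements of each type, outside of `U`. -/
theorem exists_references [Fintype E] [DecidableEq ι] [DecidableEq E] {R L : ℕ} {U : Finset E}
    (hU : U.card ≤ L) (hcard : ∀ i, L + (R + 1) ≤ (univ.filter fun a => τ a = i).card) :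
    ∃ e : ι × Fin (R + 1) → E, Function.Injective e ∧ (∀ q, τ (e q) = q.1) ∧ ∀ q, e q ∉ U := by
  have h : ∀ i, Nonempty (Fin (R + 1) ↪ {a // a ∈ (univ.filter fun a => τ a = i) \ U}) := by
    intro i
    refine Function.Embedding.nonempty_of_card_le ?_
    rw [Fintype.card_fin, Fintype.card_coe]
    have h1 := le_card_sdiff U (univ.filter fun a => τ a = i)
    have h2 := hcard i
    omega
  have hmem : ∀ i j, ((h i).some j : E) ∈ (univ.filter fun a => τ a = i) \ U :=
    fun i j => ((h i).some j).2
  have hτ : ∀ i j, τ ((h i).some j : E) = i := fun i j => by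
    have := hmem i j
    rw [mem_sdiff, mem_filter] at this
    exact this.1.2
  refine ⟨fun q => (h q.1).some q.2, ?_, fun q => hτ _ _, fun q => (mem_sdiff.1 (hmem q.1 q.2)).2⟩
  rintro ⟨i, j⟩ ⟨i', j'⟩ hq
  dsimp only at hq
  have hi : i = i' := by rw [← hτ i j, hq, hτ]
  subst hi
  rw [(h i).some.injective (Subtype.ext hq)]

/-- The pairs of sets of reference elements with equal sums of types. -/
def balancedPairs [Fintype ι] [DecidableEq ι] (t : ι → Fin n → ℤ) (R : ℕ) :
    Finset (Finset (ι × Fin (R + 1)) × Finset (ι × Fin (R + 1))) :=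
  univ.filter fun P => ∑ q ∈ P.1, t q.1 = ∑ q ∈ P.2, t q.1

open Classical in
/-- If `val` is spread out and the balanced sums of reference elements are almost annihilated by
a non-zero functional `x`, then many differences from reference elements are not. -/
theorem SpreadOut.le_card_differences [Fintype E] {R C T K : ℕ} {δ : ℝ} (hs : SpreadOut t τ val K δ)
    (hK : (C + 1) * T ≤ K)
    (hlin : ∀ (c : ι × Fin (R + 1) → ZMod p),
      (∀ S S' : Finset (ι × Fin (R + 1)), ∑ q ∈ S, t q.1 = ∑ q ∈ S', t q.1 →
        ∑ q ∈ S, c q - ∑ q ∈ S', c q ∈ interval p T) →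
      ∃ α : Fin n → ZMod p, ∀ i, c (i, 0) + ∑ k, α k * (t i k : ZMod p) ∈ interval p (C * T))
    {e : ι × Fin (R + 1) → E} {x : Fin m → ZMod p} (hx : x ≠ 0)
    (he : ∀ S S' : Finset (ι × Fin (R + 1)), ∑ q ∈ S, t q.1 = ∑ q ∈ S', t q.1 →
      x ⬝ᵥ (∑ q ∈ S, val (e q) - ∑ q ∈ S', val (e q)) ∈ interval p T) :
    δ * Fintype.card E ≤
      (univ.filter fun a => x ⬝ᵥ (val a - val (e (τ a, 0))) ∉ interval p T).card := by
  -- On references `x` is within `C * T` of a linear function of the type. An `a` differing from its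
  -- reference by at most `T` under `x` would have `x ⬝ᵥ val a + α · t` within `(C + 1) * T`, which
  -- spreading forbids for many `a`.
  obtain ⟨α, hα⟩ := hlin (fun q => x ⬝ᵥ val (e q)) fun S S' h => by
    have := he S S' h
    rwa [dotProduct_sub, dotProduct_sum, dotProduct_sum] at this
  refine (hs x hx α).trans ?_
  refine Nat.cast_le.2 (card_le_card fun a ha => ?_)
  rw [mem_filter] at ha ⊢
  refine ⟨mem_univ _, fun hc => ha.2 (interval_mono hK ?_)⟩
  have := add_mem_interval (hα (τ a)) hc
  rw [add_mul, one_mul]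
  convert this using 1
  rw [dotProduct_sub]
  ring

theorem isMove_balanced [Fintype ι] [DecidableEq E] {R : ℕ} {e : ι × Fin (R + 1) → E}
    (hinj : Function.Injective e) (hτ : ∀ q, τ (e q) = q.1) {S S' : Finset (ι × Fin (R + 1))}
    (h : ∑ q ∈ S, t q.1 = ∑ q ∈ S', t q.1) :
    IsMove (fun a => t (τ a)) val (univ.image e)
      (∑ q ∈ S, val (e q) - ∑ q ∈ S', val (e q)) := by
  refine ⟨S.image e, image_subset_image (subset_univ _), S'.image e,
    image_subset_image (subset_univ _), ?_, ?_⟩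
  · rw [sum_image hinj.injOn, sum_image hinj.injOn]
    simpa only [hτ] using h
  · rw [sum_image hinj.injOn, sum_image hinj.injOn]

theorem isMove_sub [DecidableEq E] {a b : E} (h : τ a = τ b) :
    IsMove (fun a => t (τ a)) val {a, b} (val a - val b) :=
  ⟨{a}, by simp, {b}, by simp, by simp [h], by simp⟩

/-- The `+ 2` lets the same bound serve the two-element moves of `isMove_sub`. -/
theorem card_image_references_le [Fintype ι] [DecidableEq E] {R : ℕ} (e : ι × Fin (R + 1) → E) :
    (univ.image e).card ≤ Fintype.card ι * (R + 1) + 2 := by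
  have h1 := card_image_le (s := univ) (f := e)
  rw [card_univ, Fintype.card_prod, Fintype.card_fin] at h1
  omega

variable [Fintype ι] [Fintype E] [DecidableEq ι] [DecidableEq E]

/-- The moves supported off a small set span. -/
theorem SpreadOut.span_moves [Fact p.Prime] {R C K L : ℕ} {δ : ℝ} (hs : SpreadOut t τ val K δ)
    (hlin : ∀ (c : ι × Fin (R + 1) → ZMod p),
      (∀ S S' : Finset (ι × Fin (R + 1)), ∑ q ∈ S, t q.1 = ∑ q ∈ S', t q.1 →
        ∑ q ∈ S, c q - ∑ q ∈ S', c q ∈ interval p 0) →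
      ∃ α : Fin n → ZMod p, ∀ i, c (i, 0) + ∑ k, α k * (t i k : ZMod p) ∈ interval p (C * 0))
    (hcard : ∀ i, L + (R + 1) ≤ (univ.filter fun a => τ a = i).card)
    (hL : (L : ℝ) < δ * Fintype.card E) {U : Finset E} (hU : U.card ≤ L) :
    Submodule.span (ZMod p) {v | ∃ F, Disjoint U F ∧ F.card ≤ Fintype.card ι * (R + 1) + 2 ∧
      IsMove (fun a => t (τ a)) val F v} = ⊤ := by
  classical
  obtain ⟨e, hinj, hτ, heU⟩ := exists_references hU hcard
  by_contra hne
  obtain ⟨f, hf0, hf⟩ := Submodule.exists_le_ker_of_lt_top _ (lt_top_iff_ne_top.2 hne)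
  set x : Fin m → ZMod p := fun k => f (Pi.single k 1) with hx
  have hfx : ∀ v, f v = x ⬝ᵥ v := fun v => by
    conv_lhs => rw [LinearMap.pi_apply_eq_sum_univ f v]
    refine sum_congr rfl fun k _ => ?_
    rw [smul_eq_mul, mul_comm]
    congr 2
    ext j
    simp [Pi.single_apply, eq_comm]
  have hx0 : x ≠ 0 := fun h => hf0 (LinearMap.ext fun v => by rw [hfx, h]; simp)
  have hzero : ∀ v F, Disjoint U F → F.card ≤ Fintype.card ι * (R + 1) + 2 →
      IsMove (fun a => t (τ a)) val F v → x ⬝ᵥ v ∈ interval p 0 := fun v F h1 h2 h3 => by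
    rw [mem_interval_zero, ← hfx]
    exact hf (Submodule.subset_span ⟨F, h1, h2, h3⟩)
  have hdisj : Disjoint U (univ.image e) := by
    rw [disjoint_right]
    intro a ha
    obtain ⟨q, -, rfl⟩ := mem_image.1 ha
    exact heU q
  have h := hs.le_card_differences (R := R) (C := C) (T := 0) (by simp) hlin (e := e) hx0
    fun S S' h => hzero _ _ hdisj (card_image_references_le e) (isMove_balanced hinj hτ h)
  -- A functional killing all moves kills every difference with `a ∉ U`, and `U` is too small to
  -- hold the differences that spreading provides.
  have hsub : (univ.filter fun a => x ⬝ᵥ (val a - val (e (τ a, 0))) ∉ interval p 0) ⊆ U := by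
    intro a ha
    by_contra haU
    refine (mem_filter.1 ha).2 (hzero _ {a, e (τ a, 0)} ?_ ?_ (isMove_sub (by rw [hτ])))
    · rw [disjoint_right]
      intro b hb
      rcases mem_insert.1 hb with rfl | hb
      · exact haU
      · rw [mem_singleton.1 hb]
        exact heU _
    · exact (card_insert_le _ _).trans (by simp)
  have h1 : ((univ.filter fun a => x ⬝ᵥ (val a - val (e (τ a, 0))) ∉ interval p 0).card : ℝ) ≤ L := by
    exact_mod_cast (card_le_card hsub).trans hU
  linarith

/-- Some move supported off a small set increases a given set of density at most one half. -/
theorem SpreadOut.exists_growing_move [Fact p.Prime] {R C T K L : ℕ} {δ : ℝ}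
    (hs : SpreadOut t τ val K δ) (hK : (C + 1) * T ≤ K) (hT : 1 ≤ T) (hTp : T ≤ p) (hδ : 0 < δ)
    (hlin : ∀ (c : ι × Fin (R + 1) → ZMod p),
      (∀ S S' : Finset (ι × Fin (R + 1)), ∑ q ∈ S, t q.1 = ∑ q ∈ S', t q.1 →
        ∑ q ∈ S, c q - ∑ q ∈ S', c q ∈ interval p T) →
      ∃ α : Fin n → ZMod p, ∀ i, c (i, 0) + ∑ k, α k * (t i k : ZMod p) ∈ interval p (C * T))
    (hcard : ∀ i, L + (R + 1) ≤ (univ.filter fun a => τ a = i).card)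
    (hE : 0 < Fintype.card E) (hL : (L : ℝ) ≤ δ / 2 * Fintype.card E)
    {U : Finset E} (hU : U.card ≤ L)
    {A : Finset (Fin m → ZMod p)} (hA : 2 * A.card ≤ p ^ m) :
    ∃ F v, Disjoint U F ∧ F.card ≤ Fintype.card ι * (R + 1) + 2 ∧
      IsMove (fun a => t (τ a)) val F v ∧
      min 1 (δ / 2) * T / (16 * p * ((balancedPairs t R).card + 1)) * A.card ≤ exitCount A v := by
  classical
  rcases A.eq_empty_or_nonempty with rfl | hAne
  · exact ⟨∅, 0, by simp, by simp, ⟨∅, by simp, ∅, by simp, by simp, by simp⟩, by simp⟩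
  have hA0 : (0 : ℝ) < A.card := by exact_mod_cast hAne.card_pos
  obtain ⟨e, hinj, hτ, heU⟩ := exists_references hU hcard
  have hp : (0 : ℝ) < p := by exact_mod_cast (Fact.out : p.Prime).pos
  have hT0 : (0 : ℝ) < T := by exact_mod_cast hT
  have hN : (0 : ℝ) < Fintype.card E := by exact_mod_cast hE
  have hφ : 0 < min 1 (δ / 2) := lt_min one_pos (half_pos hδ)
  set φ := min 1 (δ / 2) with hφdef
  set N : ℝ := (Fintype.card E : ℝ) with hNdef
  set b := (balancedPairs t R).card with hb
  by_contra! hcon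
  set r := φ * T / (16 * p * (b + 1)) * A.card with hr
  have hdisj : Disjoint U (univ.image e) := by
    rw [disjoint_right]
    intro a ha
    obtain ⟨q, -, rfl⟩ := mem_image.1 ha
    exact heU q
  let v : (Finset (ι × Fin (R + 1)) × Finset (ι × Fin (R + 1))) ⊕ E → Fin m → ZMod p :=
    Sum.elim (fun P => ∑ q ∈ P.1, val (e q) - ∑ q ∈ P.2, val (e q))
      (fun a => val a - val (e (τ a, 0)))
  -- One balanced pair that `x` does not nearly annihilate already has weight 1. If there is none,
  -- the differences contribute at least `δ - L / N ≥ δ / 2`. The total weight stays at most `b +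
  -- 1`.
  let ω : (Finset (ι × Fin (R + 1)) × Finset (ι × Fin (R + 1))) ⊕ E → ℝ :=
    Sum.elim (fun _ => 1) (fun _ => 1 / N)
  have hω : ∀ q, 0 ≤ ω q := by
    rintro (P | a)
    · exact zero_le_one
    · exact (by positivity : 0 ≤ 1 / N)
  have hexit : ∀ q ∈ (balancedPairs t R).disjSum Uᶜ, (exitCount A (v q) : ℝ) ≤ r := by
    rintro (P | a) hq
    · rw [inl_mem_disjSum] at hq
      exact (hcon _ _ hdisj (card_image_references_le e)
        (isMove_balanced hinj hτ (mem_filter.1 hq).2)).le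
    · rw [inr_mem_disjSum, mem_compl] at hq
      refine (hcon {a, e (τ a, 0)} _ ?_ ?_ (isMove_sub (by rw [hτ]))).le
      · rw [disjoint_right]
        intro c hc
        rcases mem_insert.1 hc with rfl | hc
        · exact hq
        · rw [mem_singleton.1 hc]
          exact heU _
      · exact (card_insert_le _ _).trans (by simp)
  have hspread : ∀ x : Fin m → ZMod p, x ≠ 0 →
      φ ≤ ∑ q ∈ (balancedPairs t R).disjSum Uᶜ with x ⬝ᵥ v q ∉ interval p T, ω q := by
    intro x hx
    by_cases hbal : ∀ S S' : Finset (ι × Fin (R + 1)), ∑ q ∈ S, t q.1 = ∑ q ∈ S', t q.1 →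
      x ⬝ᵥ (∑ q ∈ S, val (e q) - ∑ q ∈ S', val (e q)) ∈ interval p T
    · have h := hs.le_card_differences hK hlin hx hbal
      set D := univ.filter fun a => x ⬝ᵥ (val a - val (e (τ a, 0))) ∉ interval p T with hD
      have hDU : (D.card : ℝ) ≤ (D \ U).card + L := by
        have h1 := le_card_sdiff U D
        have h2 : D.card ≤ (D \ U).card + L := by omega
        exact_mod_cast h2
      calc φ ≤ δ / 2 := min_le_right _ _
        _ ≤ (D \ U).card * (1 / N) := by
          rw [mul_one_div, le_div_iff₀ hN]
          linarith
        _ = ∑ q ∈ (D \ U).map Function.Embedding.inr, ω q := by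
          rw [sum_map, ← nsmul_eq_mul, ← sum_const]
          rfl
        _ ≤ _ := by
          refine sum_le_sum_of_subset_of_nonneg ?_ fun q _ _ => hω q
          intro q hq
          obtain ⟨a, ha, rfl⟩ := mem_map.1 hq
          rw [mem_sdiff, hD, mem_filter] at ha
          exact mem_filter.2 ⟨inr_mem_disjSum.2 (mem_compl.2 ha.2), ha.1.2⟩
    · push Not at hbal
      obtain ⟨S, S', h1, h2⟩ := hbal
      refine (min_le_left _ _).trans ?_
      exact single_le_sum (f := ω) (fun q _ => hω q)
        (mem_filter.2 ⟨inl_mem_disjSum.2 (mem_filter.2 ⟨mem_univ (S, S'), h1⟩), h2⟩)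
  have hmain := le_sum_exitCount hA hT hTp ((balancedPairs t R).disjSum Uᶜ)
    (ω := ω) (fun q _ => hω q) (v := v) hφ.le hspread
  have hsumω : ∑ q ∈ (balancedPairs t R).disjSum Uᶜ, ω q ≤ b + 1 := by
    rw [sum_disjSum]
    refine add_le_add ?_ ?_
    · simp [ω, hb]
    · simp only [ω, Sum.elim_inr]
      rw [sum_const, nsmul_eq_mul, mul_one_div, div_le_one hN]
      exact Nat.cast_le.2 (card_le_univ _)
  have hr0 : 0 ≤ r := by positivity
  have hbound : ∑ q ∈ (balancedPairs t R).disjSum Uᶜ, ω q * exitCount A (v q) ≤ (b + 1) * r := by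
    calc _ ≤ ∑ q ∈ (balancedPairs t R).disjSum Uᶜ, ω q * r :=
          sum_le_sum fun q hq => mul_le_mul_of_nonneg_left (hexit q hq) (hω q)
      _ = (∑ q ∈ (balancedPairs t R).disjSum Uᶜ, ω q) * r := (sum_mul _ _ _).symm
      _ ≤ _ := by gcongr
  have hfinal : φ * T * A.card ≤ φ * T * A.card / 2 := by
    calc φ * T * A.card ≤ 8 * p * ((b + 1) * r) := hmain.trans (by gcongr)
      _ = φ * T * A.card / 2 := by
        rw [hr]
        field_simp
        ring
  have : 0 < φ * T * A.card := by positivity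
  linarith

end Spread

/-! ### Choice of constants and the covering of `𝔽_p^m`. -/

section Core

open Finset

/-- Two sets of more than half of the elements of a finite group have all elements as sums. -/
theorem exists_add_eq_of_card {G : Type*} [Fintype G] [DecidableEq G] [AddCommGroup G]
    {A A' : Finset G} (hA : Fintype.card G < 2 * A.card) (hA' : Fintype.card G < 2 * A'.card)
    (u : G) : ∃ a ∈ A, ∃ a' ∈ A', a + a' = u := by
  have hcard : (A'.image fun a => u - a).card = A'.card :=
    card_image_of_injective _ sub_right_injective
  obtain ⟨a, ha⟩ := inter_nonempty_of_card_lt_card_add_card (subset_univ A)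
    (subset_univ (A'.image fun a => u - a)) (by rw [hcard, card_univ]; omega)
  rw [mem_inter, mem_image] at ha
  obtain ⟨h1, a', h2, rfl⟩ := ha
  exact ⟨_, h1, a', h2, by abel⟩

/-- Spread out families, with many elements of each type, have subset sums that are arbitrary in
`𝔽_p^m` with a prescribed sum of types. -/
theorem exists_subset_sums {ι : Type*} [Fintype ι] [Nonempty ι] [DecidableEq ι] {n m : ℕ}
    (t : ι → Fin n → ℤ) (hm : 1 ≤ m) {δ μ : ℝ} (hδ : 0 < δ) (hμ : 0 < μ) :
    ∃ K p₀ : ℕ, ∀ p : ℕ, p.Prime → p₀ < p → ∀ (E : Type) [Fintype E] (τ : E → ι)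
      (val : E → Fin m → ZMod p),
      (∀ i, μ * p ≤ ((univ.filter fun a => τ a = i).card : ℝ)) → SpreadOut t τ val K δ →
      ∃ t₀ : Fin n → ℤ, ∀ u : Fin m → ZMod p, ∃ S : Finset E,
        ∑ a ∈ S, t (τ a) = t₀ ∧ ∑ a ∈ S, val a = u := by
  obtain ⟨R, C, p₁, hlin⟩ := exists_linear_approx t
  set B := Fintype.card ι * (R + 1) + 2 with hB
  set b := (balancedPairs t R).card with hb
  set φ := min 1 (δ / 2) with hφdef
  have hφ : 0 < φ := lt_min one_pos (half_pos hδ)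
  set δ' := min δ 1 with hδ'
  have hδ'0 : 0 < δ' := lt_min hδ one_pos
  have hδ'1 : δ' ≤ 1 := min_le_right _ _
  have hδ'δ : δ' ≤ δ := min_le_left _ _
  set μ' := min μ 1 with hμ'
  have hμ'0 : 0 < μ' := lt_min hμ one_pos
  have hμ'1 : μ' ≤ 1 := min_le_right _ _
  have hμ'μ : μ' ≤ μ := min_le_left _ _
  have hB2 : (2 : ℝ) ≤ B := by
    rw [hB]
    push_cast
    have : (0 : ℝ) ≤ Fintype.card ι * (R + 1) := by positivity
    linarith
  -- Two runs of `2 * k` moves with supports of size at most `B`, where `k ≈ η * p`, use at most `4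
  -- * k * B` elements; this `η` keeps that below half of each type and below `δ / 2` of `E`.
  set η := δ' * μ' / (8 * B) with hη
  have hη0 : 0 < η := by positivity
  have hηB : 4 * (η * B) = δ' * μ' / 2 := by
    rw [hη]
    field_simp
    norm_num
  have hη1 : η ≤ 1 := by
    have : δ' * μ' ≤ 1 := mul_le_one₀ hδ'1 hμ'0.le hμ'1
    nlinarith
  have hm0 : (0 : ℝ) < m := by exact_mod_cast hm
  set c : ℝ := 2 * m * 2 ^ m with hc
  have hc0 : 0 < c := by positivity
  set ε := (η / 2 / c) ^ m with hε
  have hε0 : 0 < ε := by positivity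
  -- The spanning moves give density `ε`; `T` is large enough that the factor `1 + k * ρ`, with `k *
  -- ρ` of order `η * φ * T / b`, lifts this above 1/2.
  obtain ⟨T, hT⟩ := exists_nat_gt (max 1 (16 * (b + 1) / (ε * η * φ)))
  have hT1 : (1 : ℝ) < T := (le_max_left _ _).trans_lt hT
  have hT2 : 16 * (b + 1) < T * (ε * η * φ) := by
    rw [← div_lt_iff₀ (by positivity)]
    exact (le_max_right _ _).trans_lt hT
  obtain ⟨p₂, hp₂⟩ := exists_nat_ge (max (2 / η) (2 * (R + 1) / μ))
  refine ⟨(C + 1) * T, p₁ + T + p₂, fun p hp hlt E _ τ val hcard hs => ?_⟩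
  classical
  have := Fact.mk hp
  have hp0 : (0 : ℝ) < p := by exact_mod_cast hp.pos
  have hpp₂ : (p₂ : ℝ) ≤ p := by exact_mod_cast (by omega : p₂ ≤ p)
  have hηp : 2 ≤ p * η := by
    rw [← div_le_iff₀ hη0]
    exact ((le_max_left _ _).trans hp₂).trans hpp₂
  have hRp : 2 * (R + 1) ≤ p * μ := by
    rw [← div_le_iff₀ hμ]
    exact ((le_max_right _ _).trans hp₂).trans hpp₂
  set k := ⌊η * p⌋₊ with hk
  have hk1 : (k : ℝ) ≤ η * p := Nat.floor_le (by positivity)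
  have hk2 : η * p / 2 ≤ k := by
    have := Nat.lt_floor_add_one (η * p)
    rw [← hk] at this
    linarith
  have hkp : k ≤ p := by
    have : (k : ℝ) ≤ p := hk1.trans (by nlinarith)
    exact_mod_cast this
  set L := 4 * (k * B) with hL
  have hLr : (L : ℝ) ≤ δ' * μ' / 2 * p := by
    rw [← hηB, hL]
    push_cast
    have : (k : ℝ) * B ≤ η * p * B := by gcongr
    linarith
  have hLμ : (L : ℝ) ≤ μ * p / 2 := by
    have h1 : δ' * μ' ≤ 1 * μ := mul_le_mul hδ'1 hμ'μ hμ'0.le zero_le_one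
    nlinarith
  have hfib : ∀ i, L + (R + 1) ≤ (univ.filter fun a => τ a = i).card := fun i => by
    have h1 := hcard i
    have h2 : ((L + (R + 1) : ℕ) : ℝ) ≤ ((univ.filter fun a => τ a = i).card : ℝ) := by
      push_cast
      linarith
    exact_mod_cast h2
  have hE : μ * p ≤ Fintype.card E := by
    obtain ⟨i⟩ := ‹Nonempty ι›
    refine (hcard i).trans ?_
    exact_mod_cast card_le_univ _
  have hE0 : (0 : ℝ) < Fintype.card E := lt_of_lt_of_le (by positivity) hE
  have hLE : (L : ℝ) ≤ δ / 2 * Fintype.card E := by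
    have h1 : δ' * μ' ≤ δ * μ := mul_le_mul hδ'δ hμ'μ hμ'0.le hδ.le
    calc (L : ℝ) ≤ δ' * μ' / 2 * p := hLr
      _ ≤ δ * μ / 2 * p := by gcongr
      _ = δ / 2 * (μ * p) := by ring
      _ ≤ _ := by gcongr
  have hLE' : (L : ℝ) < δ * Fintype.card E := by
    have : 0 < δ * Fintype.card E := by positivity
    linarith
  have hT1' : 1 ≤ T := by exact_mod_cast hT1.le
  set ρ := φ * T / (16 * p * (b + 1)) with hρ
  have hρ0 : 0 ≤ ρ := by positivity
  have hspan : ∀ U : Finset E, U.card ≤ L → Submodule.span (ZMod p)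
      {v | ∃ F, Disjoint U F ∧ F.card ≤ B ∧ IsMove (fun a => t (τ a)) val F v} = ⊤ :=
    fun U hU => hs.span_moves (hlin p hp (by omega) 0) hfib hLE' hU
  have hgrow : ∀ U : Finset E, U.card ≤ L → ∀ A : Finset (Fin m → ZMod p), 2 * A.card ≤ p ^ m →
      ∃ F v, Disjoint U F ∧ F.card ≤ B ∧ IsMove (fun a => t (τ a)) val F v ∧
        ρ * A.card ≤ exitCount A v :=
    fun U hU A hA => hs.exists_growing_move le_rfl hT1' (by omega) hδ (hlin p hp (by omega) T)
      hfib (by exact_mod_cast hE0) hLE hU hA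
  have hkρ : (p : ℝ) ^ m < 2 * (((k : ℝ) / c) ^ m * (1 + k * ρ)) := by
    have h1 : ε * (p : ℝ) ^ m ≤ ((k : ℝ) / c) ^ m := by
      rw [hε, ← mul_pow]
      gcongr
      rw [div_mul_eq_mul_div]
      gcongr
      linarith
    have h2 : η * φ * T / (32 * (b + 1)) ≤ k * ρ := by
      calc η * φ * T / (32 * (b + 1)) = η * p / 2 * ρ := by
            rw [hρ]
            field_simp
            norm_num
        _ ≤ _ := by gcongr
    have h3 : 1 < 2 * (ε * (η * φ * T / (32 * (b + 1)))) := by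
      rw [← mul_div_assoc, ← mul_div_assoc, one_lt_div (by positivity)]
      linarith
    calc (p : ℝ) ^ m = p ^ m * 1 := (mul_one _).symm
      _ < p ^ m * (2 * (ε * (η * φ * T / (32 * (b + 1))))) := by gcongr
      _ = 2 * (ε * p ^ m * (η * φ * T / (32 * (b + 1)))) := by ring
      _ ≤ 2 * (((k : ℝ) / c) ^ m * (1 + k * ρ)) := by
        gcongr
        linarith
  obtain ⟨F₁, A₁, -, hF₁, hA₁, hA₁c⟩ := exists_realizes_half hm hρ0 hspan hgrow (U := ∅) hkp
    (by rw [card_empty]; omega) hkρ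
  obtain ⟨F₂, A₂, hd, -, hA₂, hA₂c⟩ := exists_realizes_half hm hρ0 hspan hgrow (U := F₁) hkp
    (by omega) hkρ
  obtain ⟨t₀, ht₀⟩ := hA₁.add hA₂ hd
  refine ⟨t₀, fun u => ?_⟩
  have hcardG : Fintype.card (Fin m → ZMod p) = p ^ m := by simp [ZMod.card]
  obtain ⟨a, ha, a', ha', rfl⟩ := exists_add_eq_of_card (A := A₁) (A' := A₂)
    (by rwa [hcardG]) (by rwa [hcardG]) u
  exact ht₀ a ha a' ha'

end Core

/-! ### Multisets as families indexed by their occurrences. -/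

section Multisets

open Finset

variable {ι α β : Type*} [Fintype ι] [DecidableEq β] {f : ι → α}
  {X : α → Multiset β}

theorem map_filter_eq [DecidableEq α] (hf : Function.Injective f) (i : ι) :
    ((univ.filter fun a : Σ i, (X (f i)).ToType => f a.1 = f i).val.map fun a => (a.2 : β)) =
      X (f i) := by
  classical
  have h : (univ.filter fun a : Σ i, (X (f i)).ToType => f a.1 = f i) =
      univ.map (Function.Embedding.sigmaMk i) := by
    ext ⟨j, b⟩
    simp only [mem_filter, mem_univ, true_and, mem_map, Function.Embedding.sigmaMk_apply]
    constructor
    · intro hj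
      obtain rfl := hf hj
      exact ⟨b, rfl⟩
    · rintro ⟨b', hb⟩
      rw [← (Sigma.mk.inj_iff.1 hb).1]
  rw [h, map_val, Multiset.map_map]
  exact Multiset.map_univ_coe (X (f i))

theorem map_univ_eq_sum :
    ((univ : Finset (Σ i, (X (f i)).ToType)).val.map fun a => (a.2 : β)) = ∑ i, X (f i) := by
  rw [← Multiset.sum_map_singleton
    ((univ : Finset (Σ i, (X (f i)).ToType)).val.map fun a => (a.2 : β)), Multiset.map_map]
  change ∑ a : Σ i, (X (f i)).ToType, {(a.2 : β)} = _
  rw [Fintype.sum_sigma]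
  refine sum_congr rfl fun i _ => ?_
  conv_rhs => rw [← Multiset.map_univ_coe (X (f i)), ← Multiset.sum_map_singleton (Multiset.map _ _),
    Multiset.map_map]
  rfl

end Multisets

/-! ### Passage from `Y` to integer types, and uniformity in `Y`. -/

section Final

open Finset

/-- The affine function with the given coefficients. -/
def affineOfCoeffs {p l m : ℕ} (x : Fin m → ZMod p) (α : Fin (l + 1) → ZMod p) :
    (Fin (l + m) → ZMod p) →ᵃ[ZMod p] ZMod p :=
  (∑ k, x k • LinearMap.proj (Fin.natAdd l k) +
    ∑ k : Fin l, α k.succ • LinearMap.proj (Fin.castAdd m k) :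
      (Fin (l + m) → ZMod p) →ₗ[ZMod p] ZMod p).toAffineMap +
    AffineMap.const (ZMod p) (Fin (l + m) → ZMod p) (α 0)

theorem affineOfCoeffs_apply {p l m : ℕ} (x : Fin m → ZMod p) (α : Fin (l + 1) → ZMod p)
    (v : Fin (l + m) → ZMod p) : affineOfCoeffs x α v = (x ⬝ᵥ fun k => v (Fin.natAdd l k)) +
      ∑ k : Fin l, α k.succ * v (Fin.castAdd m k) + α 0 := by
  simp [affineOfCoeffs, dotProduct]

theorem not_constantOn_affineOfCoeffs {p l m : ℕ} {x : Fin m → ZMod p} (hx : x ≠ 0)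
    (α : Fin (l + 1) → ZMod p) :
    ¬ ConstantOn (affineOfCoeffs x α) (fiber m (0 : Fin l → ZMod p)) := by
  intro h
  obtain ⟨k, hk⟩ := Function.ne_iff.1 hx
  have := h (Fin.append 0 (Pi.single k 1)) ⟨_, rfl⟩ (Fin.append 0 0) ⟨_, rfl⟩
  simp [affineOfCoeffs_apply] at this
  exact hk this

theorem intCast_injOn_box {p K l : ℕ} (hp : 2 * K < p) {a b : Fin l → ℤ}
    (ha : a ∈ Icc (fun _ => -(K : ℤ)) (fun _ => (K : ℤ)))
    (hb : b ∈ Icc (fun _ => -(K : ℤ)) (fun _ => (K : ℤ)))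
    (h : (fun i => (a i : ZMod p)) = fun i => (b i : ZMod p)) : a = b := by
  rw [mem_Icc] at ha hb
  funext i
  have h1 := congrFun h i
  rw [ZMod.intCast_eq_intCast_iff_dvd_sub] at h1
  have h2 := ha.1 i
  have h3 := ha.2 i
  have h4 := hb.1 i
  have h5 := hb.2 i
  dsimp only at h2 h3 h4 h5
  have h6 := Int.eq_zero_of_abs_lt_dvd h1 (by rw [abs_lt]; constructor <;> omega)
  omega

/-- The claim for a fixed set `Y₀` of integer lifts of the points of `Y`. -/
theorem exists_subset_sums_of_lift (l m : ℕ) {δ μ : ℝ} (hδ : 0 < δ) (hμ : 0 < μ)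
    (Y₀ : Finset (Fin l → ℤ)) :
    ∃ K₀ p₀ : ℕ, ∀ K₂ : ℕ, K₀ ≤ K₂ → ∀ p : ℕ, p.Prime → p₀ < p →
      ∀ (Y : Finset (Fin l → ZMod p)), Y.Nonempty →
        Set.InjOn (fun (a : Fin l → ℤ) i => (a i : ZMod p)) Y₀ →
        Y₀.image (fun (a : Fin l → ℤ) i => (a i : ZMod p)) = Y →
      ∀ (X : (Fin l → ZMod p) → Multiset (Fin (l + m) → ZMod p)),
        (∀ y ∈ Y, ∀ x ∈ X y, x ∈ fiber m y) →
        (∀ y ∈ Y, μ * (p : ℝ) ≤ (Multiset.card (X y) : ℝ)) →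
        (∀ ξ : (Fin (l + m) → ZMod p) →ᵃ[ZMod p] ZMod p,
          ¬ ConstantOn ξ (fiber m (0 : Fin l → ZMod p)) → Thick (∑ y ∈ Y, X y) K₂ δ ξ) →
      ∃ (u₀ : Fin l → ZMod p) (k : ℕ), ∀ u : Fin m → ZMod p,
        ∃ S : (Fin l → ZMod p) → Multiset (Fin (l + m) → ZMod p),
          (∀ y ∈ Y, S y ≤ X y) ∧
          ∑ y ∈ Y, (S y).sum = Fin.append u₀ u ∧
          ∑ y ∈ Y, Multiset.card (S y) = k := by
  rcases Nat.eq_zero_or_pos m with rfl | hm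
  · refine ⟨0, 0, fun K₂ _ p _ _ Y _ _ _ X _ _ _ => ⟨0, 0, fun u => ⟨fun _ => 0, ?_, ?_, ?_⟩⟩⟩
    · simp
    · rw [Subsingleton.elim u 0]
      ext i
      refine Fin.addCases (fun i => ?_) (fun i => i.elim0) i
      rw [Fin.append_left]
      simp
    · simp
  rcases Y₀.eq_empty_or_nonempty with rfl | hY₀
  · refine ⟨0, 0, fun K₂ _ p _ _ Y hY _ hYY => ?_⟩
    rw [image_empty] at hYY
    exact absurd hY (by simp [← hYY])
  have : Nonempty Y₀ := hY₀.to_subtype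
  -- Coordinate 0 of a type sum counts the summands, and its coefficient `α 0` is the constant term
  -- of the affine function.
  let t : Y₀ → Fin (l + 1) → ℤ := fun y => Fin.cons 1 y.1
  obtain ⟨K₀, p₀, hmain⟩ := exists_subset_sums t hm hδ hμ
  refine ⟨K₀, p₀, fun K₂ hK₂ p hp hlt Y hY hinj hYY X hX hcard hthick => ?_⟩
  let f : Y₀ → Fin l → ZMod p := fun y i => (y.1 i : ZMod p)
  have hf : Function.Injective f := fun a b h => Subtype.ext (hinj a.2 b.2 h)
  have hfY : ∀ y, f y ∈ Y := fun y => by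
    rw [← hYY]
    exact mem_image_of_mem _ y.2
  have hYf : ∀ y ∈ Y, ∃ i, f i = y := fun y hy => by
    rw [← hYY] at hy
    obtain ⟨i, hi, h⟩ := mem_image.1 hy
    exact ⟨⟨i, hi⟩, h⟩
  have hYimage : univ.image f = Y := by
    ext y
    simp only [mem_image, mem_univ, true_and]
    exact ⟨fun ⟨i, hi⟩ => hi ▸ hfY i, hYf y⟩
  let E := Σ i, (X (f i)).ToType
  let pt : E → Fin (l + m) → ZMod p := fun a => a.2
  let val : E → Fin m → ZMod p := fun a k => pt a (Fin.natAdd l k)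
  have hpt : ∀ a : E, pt a = Fin.append (f a.1) (val a) := by
    intro a
    obtain ⟨v, hv⟩ := hX (f a.1) (hfY a.1) (pt a) (Multiset.coe_mem (x := a.2))
    have : val a = v := by
      ext k
      simp only [val, hv, Fin.append_right]
    rw [this, hv]
  have hfib : ∀ i, ((univ.filter fun a : E => f a.1 = f i).val.map pt) = X (f i) :=
    fun i => map_filter_eq hf i
  have htotal : (univ : Finset E).val.map pt = ∑ y ∈ Y, X y := by
    rw [← hYimage, sum_image hf.injOn]
    exact map_univ_eq_sum
  have hcardE : Fintype.card E = Multiset.card (∑ y ∈ Y, X y) := by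
    rw [← htotal, Multiset.card_map]
    rfl
  obtain ⟨t₀, ht₀⟩ := hmain p hp hlt E Sigma.fst val (fun i => by
    refine (hcard (f i) (hfY i)).trans_eq ?_
    rw [← hfib i, Multiset.card_map]
    simp only [hf.eq_iff]
    rfl) (by
    classical
    intro x hx α
    have h := hthick (affineOfCoeffs x α) (not_constantOn_affineOfCoeffs hx α)
    unfold Thick at h
    rw [← hcardE, ← htotal, Multiset.filter_map, Multiset.card_map] at h
    refine h.trans ?_
    refine Nat.cast_le.2 (Multiset.card_le_card ?_)
    rw [Finset.filter_val]
    refine Multiset.monotone_filter_right _ fun a ha => ?_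
    refine fun hc => ha (interval_mono hK₂ ?_)
    convert hc using 1
    rw [affineOfCoeffs_apply, Fin.sum_univ_succ, add_assoc]
    congr 1
    simp only [hpt a, Fin.append_left, t, Fin.cons_zero, Fin.cons_succ, f]
    push_cast
    ring)
  refine ⟨fun i => (t₀ i.succ : ZMod p), (t₀ 0).toNat, fun u => ?_⟩
  obtain ⟨S, hS1, hS2⟩ := ht₀ u
  have hSY : ∀ a ∈ S, f a.1 ∈ Y := fun a _ => hfY a.1
  refine ⟨fun y => (S.filter fun a => f a.1 = y).val.map pt, ?_, ?_, ?_⟩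
  · intro y hy
    obtain ⟨i, rfl⟩ := hYf y hy
    rw [← hfib i]
    exact Multiset.map_le_map (val_le_iff.2 (filter_subset_filter _ (subset_univ S)))
  · have h1 : ∑ y ∈ Y, ((S.filter fun a => f a.1 = y).val.map pt).sum = ∑ a ∈ S, pt a :=
      sum_fiberwise_of_maps_to hSY pt
    rw [h1]
    ext j
    rw [Finset.sum_apply]
    refine Fin.addCases (fun i => ?_) (fun i => ?_) j
    · simp only [hpt, Fin.append_left, f]
      rw [← hS1, Finset.sum_apply]
      simp [t]
    · rw [Fin.append_right, ← hS2, Finset.sum_apply]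
  · simp only [Multiset.card_map]
    have h1 : ∑ y ∈ Y, (S.filter fun a => f a.1 = y).card = S.card :=
      (card_eq_sum_card_fiberwise hSY).symm
    refine Eq.trans h1 ?_
    rw [← hS1, Finset.sum_apply]
    simp [t]

end Final
end SubsetSums

theorem proposition1 (d K : ℕ) (hd : 1 ≤ d) (hK : 1 ≤ K) (δ μ : ℝ) (hδ : 0 < δ) (hμ : 0 < μ) :
    ∃ K₀ p₀ : ℕ, ∀ K₂ : ℕ, K < K₂ → K₀ ≤ K₂ → ∀ p : ℕ, p.Prime → p₀ < p →
      ∀ l m : ℕ, l + m = d →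
      ∀ (Y : Finset (Fin l → ZMod p)), Y.Nonempty →
        (∀ y ∈ Y, ∀ i : Fin l, y i ∈ SubsetSums.interval p K) →
      ∀ (X : (Fin l → ZMod p) → Multiset (Fin (l + m) → ZMod p)),
        (∀ y ∈ Y, ∀ x ∈ X y, x ∈ SubsetSums.fiber m y) →
        (∀ y ∈ Y, μ * (p : ℝ) ≤ (Multiset.card (X y) : ℝ)) →
        (∀ ξ : (Fin (l + m) → ZMod p) →ᵃ[ZMod p] ZMod p,
          ¬ SubsetSums.ConstantOn ξ (SubsetSums.fiber m (0 : Fin l → ZMod p)) →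
          SubsetSums.Thick (∑ y ∈ Y, X y) K₂ δ ξ) →
      ∃ (u₀ : Fin l → ZMod p) (k : ℕ), ∀ u : Fin m → ZMod p,
        ∃ S : (Fin l → ZMod p) → Multiset (Fin (l + m) → ZMod p),
          (∀ y ∈ Y, S y ≤ X y) ∧
          ∑ y ∈ Y, (S y).sum = Fin.append u₀ u ∧
          ∑ y ∈ Y, Multiset.card (S y) = k := by
  classical
  choose K₀ p₀ hmain using fun (l m : ℕ) (Y₀ : Finset (Fin l → ℤ)) =>
    SubsetSums.exists_subset_sums_of_lift l m hδ hμ Y₀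
  let box : (l : ℕ) → Finset (Fin l → ℤ) := fun l =>
    Finset.Icc (fun _ => -(K : ℤ)) (fun _ => (K : ℤ))
  -- Sums over all possible sets of lifts serve as upper bounds for each single constant; `2 * K`
  -- makes reduction mod `p` injective on the box.
  refine ⟨∑ l ∈ Finset.range (d + 1), ∑ Y₀ ∈ (box l).powerset, K₀ l (d - l) Y₀,
    ∑ l ∈ Finset.range (d + 1), ∑ Y₀ ∈ (box l).powerset, p₀ l (d - l) Y₀ + 2 * K,
    fun K₂ _ hK₂ p hp hlt l m hlm Y hY hYK => ?_⟩
  obtain rfl : m = d - l := by omega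
  have hle : ∀ (g : (l : ℕ) → Finset (Fin l → ℤ) → ℕ) (Y₀ : Finset (Fin l → ℤ)), Y₀ ⊆ box l →
      g l Y₀ ≤ ∑ l ∈ Finset.range (d + 1), ∑ Y₀ ∈ (box l).powerset, g l Y₀ := fun g Y₀ h =>
    (Finset.single_le_sum (f := g l) (fun _ _ => Nat.zero_le _) (Finset.mem_powerset.2 h)).trans
      (Finset.single_le_sum (f := fun l => ∑ Y₀ ∈ (box l).powerset, g l Y₀)
        (fun _ _ => Nat.zero_le _) (Finset.mem_range.2 (by omega)))
  let Y₀ := (box l).filter fun a => (fun i => (a i : ZMod p)) ∈ Y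
  have hY₀ : Y₀ ⊆ box l := Finset.filter_subset _ _
  have h1 := hle (fun l Y₀ => K₀ l (d - l) Y₀) Y₀ hY₀
  have h2 := hle (fun l Y₀ => p₀ l (d - l) Y₀) Y₀ hY₀
  refine hmain l (d - l) Y₀ K₂ (h1.trans hK₂) p hp (by omega) Y hY ?_ ?_
  · intro a ha b hb hab
    exact SubsetSums.intCast_injOn_box (by omega) (hY₀ ha) (hY₀ hb) hab
  · ext y
    rw [Finset.mem_image]
    constructor
    · rintro ⟨a, ha, rfl⟩
      exact (Finset.mem_filter.1 ha).2
    · intro hy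
      choose a ha1 ha2 ha3 using hYK y hy
      have hay : (fun i => (a i : ZMod p)) = y := funext ha3
      exact ⟨a, Finset.mem_filter.2 ⟨Finset.mem_Icc.2 ⟨ha1, ha2⟩, by rwa [hay]⟩, hay⟩
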